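/- **Setting (0. Permutations).** Let $\mathfrak S_n$ be the set of permutations $\sigma=\sigma_1\cdots\sigma_n$ of $[n]=\{1,\dots,n\}$, with the weak order: $\sigma\le\tau$ iff $\mathrm{inv}(\sigma)\subseteq\mathrm{inv}(\tau)$, where $\mathrm{inv}(\sigma)=\{(\sigma_i,\sigma_j) : i<j,\ \sigma_i>\sigma_j\}$. It is a lattice. For $\sigma\in\mathfrak S_m$, $\tau\in\mathfrak S_n$ let $\sigma\backslash\tau=\sigma_1\cdots\sigma_m(m+\tau_1)\cdots(m+\tau_n)$ and $\tau/\sigma=(m+\tau_1)\cdots(m+\tau_n)\sigma_1\cdots\sigma_m$ in $\mathfrak S_{m+n}$. The shifted shuffle of $\sigma$ and $\tau$ is the set of $\rho\in\mathfrak S_{m+n}$ whose subword on the values $[m]$ is $\sigma$ and whose subword on the values $[m+n]\setminus[m]$ standardizes to $\tau$. **1. Arcs.** An arc is $(a,b,n,S)$ with $1\le a<b\le n$ and $S\subseteq\,]a,b[\,=\{a+1,\dots,b-1\}$. Arcs $(a,b,n,R)$ and $(c,d,n,S)$ cross if there are $r,s\in([a,b]\cap[c,d])\setminus(\{a,b\}\cap\{c,d\})$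 with $r\in(R\cup\{a,b\})\setminus S$ and $s\in(S\cup\{c,d\})\setminus R$. A noncrossing arc diagram is a set of arcs (same $n$) any two distinct ones of which do not cross and have distinct left endpoints and distinct right endpoints. For $\sigma\in\mathfrak S_n$, let $\underline\delta(\sigma)$ be the set of arcs $(\sigma_{i+1},\sigma_i,n,\{\sigma_j : j<i,\ \sigma_{i+1}<\sigma_j<\sigma_i\})$ over all descents $\sigma_i>\sigma_{i+1}$. **2. Arc ideals and congruences.** An arc ideal is a set $\mathcal I$ of arcs with given $n$ such that $(a,d,n,S)\in\mathcal I$ implies $(b,c,n,S\cap\,]b,c[)\in\mathcal I$ for all $a\le b<c\le d$. For an arc ideal $\mathcal I$, let $\equiv_{\mathcal I}$ be the (unique) lattice congruence of the weak order on $\mathfrak S_n$ such that $\mathcal I$ is the set of arcs $\alpha$ with $\underline\delta(\sigma)=\{\alpha\}$ for some join-irreducible $\sigma$ that is the bottom of its class. Put $\underline\eta_{\mathcal I}(\sigma)=\underline\delta(\pi_\downarrow(\sigma))$, where $\pi_\downarrow(\sigma)$ is the bottom of the $\equiv_{\mathcal I}$-class of $\sigma$. The map $\underline\eta_{\mathcal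 I}$ identifies the classes with the noncrossing arc diagrams contained in $\mathcal I$; the latter are ordered as the lattice quotient: $\mathcal D\le\mathcal E$ iff there are $\sigma\le\tau$ with $\underline\eta_{\mathcal I}(\sigma)=\mathcal D$ and $\underline\eta_{\mathcal I}(\tau)=\mathcal E$. **3. Decorations.** A decoration set is a graded set $\mathfrak X=\bigsqcup_{n\ge0}\mathfrak X_n$ with a concatenation $\mathfrak X_m\times\mathfrak X_n\to\mathfrak X_{m+n}$, $(\mathcal X,\mathcal Y)\mapsto\mathcal X\mathcal Y$, and a selection $\mathfrak X_m\times\binom{[m]}{k}\to\mathfrak X_k$, $(\mathcal X,R)\mapsto\mathcal X|_R$, such that concatenation is associative, $(\mathcal X|_R)|_S=\mathcal X|_{\{r_s : s\in S\}}$ for $R=\{r_1<\dots<r_q\}$ and $S\subseteq[q]$, and $\mathcal X|_R\,\mathcal Y|_S=(\mathcal X\mathcal Y)|_{R\cup(S+m)}$ for $\mathcal X\in\mathfrak X_m$, $\mathcal Y\in\mathfrak X_n$, $R\subseteq[m]$, $S\subseteq[n]$. Fix a conservative function, that is, a map $\mathrm{arcs}$ sending each $\mathcal X\in\mathfrak X_n$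 to an arc ideal of arcs of size $n$, such that (i) for $\mathcal X\in\mathfrak X_m$ and $\mathcal Y\in\mathfrak X_n$, $(a,b,m,S)\in\mathrm{arcs}(\mathcal X)$ implies $(a,b,m+n,S)\in\mathrm{arcs}(\mathcal X\mathcal Y)$, and $(a,b,n,S)\in\mathrm{arcs}(\mathcal Y)$ implies $(a+m,b+m,m+n,S+m)\in\mathrm{arcs}(\mathcal X\mathcal Y)$; (ii) for $\mathcal Z\in\mathfrak X_p$, $R=\{r_1<\dots<r_q\}\subseteq[p]$, $1\le a<b\le q$ and $S\subseteq\,]r_a,r_b[$, $(r_a,r_b,p,S)\in\mathrm{arcs}(\mathcal Z)$ implies $(a,b,q,\{c\in[q] : r_c\in S\})\in\mathrm{arcs}(\mathcal Z|_R)$. **4. The algebra.** Over a field $\mathbf k$, consider the vector space with basis $\mathbb F_{(\sigma,\mathcal X)}$, for $n\ge0$, $\sigma\in\mathfrak S_n$, $\mathcal X\in\mathfrak X_n$, with the bilinear product $\mathbb F_{(\sigma,\mathcal X)}\cdot\mathbb F_{(\tau,\mathcal Y)}=\sum_\rho\mathbb F_{(\rho,\mathcal X\mathcal Y)}$, where $\rho$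 ranges over the shifted shuffle of $\sigma$ and $\tau$. For $\mathcal X\in\mathfrak X_n$ and a noncrossing arc diagram $\mathcal D\subseteq\mathrm{arcs}(\mathcal X)$ put $$\mathbb P_{(\mathcal D,\mathcal X)}=\sum_{\sigma\in\mathfrak S_n,\ \underline\eta_{\mathrm{arcs}(\mathcal X)}(\sigma)=\mathcal D}\mathbb F_{(\sigma,\mathcal X)}.$$ **Proposition.** Let $\mathcal X\in\mathfrak X_m$, $\mathcal Y\in\mathfrak X_n$, and let $\mathcal D\subseteq\mathrm{arcs}(\mathcal X)$ and $\mathcal E\subseteq\mathrm{arcs}(\mathcal Y)$ be noncrossing arc diagrams. Then $\underline\eta_{\mathrm{arcs}(\mathcal X)}^{-1}(\mathcal D)=[\mu,\nu]$ and $\underline\eta_{\mathrm{arcs}(\mathcal Y)}^{-1}(\mathcal E)=[\lambda,\omega]$ are nonempty intervals of the weak orders on $\mathfrak S_m$ and $\mathfrak S_n$, and $$\mathbb P_{(\mathcal D,\mathcal X)}\cdot\mathbb P_{(\mathcal E,\mathcal Y)}=\sum_{\mathcal F}\mathbb P_{(\mathcal F,\mathcal X\mathcal Y)},$$ where $\mathcal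 F$ ranges over the interval between $\underline\eta_{\mathrm{arcs}(\mathcal X\mathcal Y)}(\mu\backslash\lambda)$ and $\underline\eta_{\mathrm{arcs}(\mathcal X\mathcal Y)}(\omega/\nu)$ in the lattice of noncrossing arc diagrams contained in $\mathrm{arcs}(\mathcal X\mathcal Y)$. -/

import Mathlib

universe u v

namespace ArcHopf

open Finset

/-! ### The weak order on the permutations of `Fin n`

A permutation `σ₁ … σₙ` is the word `σ 0, …, σ (n-1)`: arguments are positions, images are values.
All positions and values are indexed from `0` instead of `1`. -/

/-- The inversion set: the pairs `(σ i, σ j)` of values with `i < j` and `σ i > σ j`. -/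
def invSet {n : ℕ} (σ : Equiv.Perm (Fin n)) : Set (Fin n × Fin n) :=
  {p | ∃ i j : Fin n, i < j ∧ σ j < σ i ∧ p = (σ i, σ j)}

theorem mem_invSet {n : ℕ} (σ : Equiv.Perm (Fin n)) (b a : Fin n) :
    (b, a) ∈ invSet σ ↔ a < b ∧ σ.symm b < σ.symm a := by
  constructor
  · rintro ⟨i, j, hij, hσ, h⟩
    obtain ⟨rfl, rfl⟩ := Prod.mk.inj h
    simpa using ⟨hσ, hij⟩
  · rintro ⟨h1, h2⟩
    exact ⟨σ.symm b, σ.symm a, h2, by simpa using h1, by simp⟩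

/-- The weak order: inclusion of inversion sets. -/
instance weakOrder (n : ℕ) : PartialOrder (Equiv.Perm (Fin n)) where
  le σ τ := invSet σ ⊆ invSet τ
  le_refl _ := subset_rfl
  le_trans _ _ _ h₁ h₂ := h₁.trans h₂
  le_antisymm σ τ h₁ h₂ := by
    have key : ∀ a b : Fin n, σ.symm a < σ.symm b → τ.symm a < τ.symm b := by
      intro a b hab
      rcases lt_trichotomy a b with h | h | h
      · by_contra hc
        have hne : τ.symm b ≠ τ.symm a := fun e => h.ne' (τ.symm.injective e)
        have := h₂ ((mem_invSet τ b a).2 ⟨h, lt_of_le_of_ne (not_lt.1 hc) hne⟩)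
        exact absurd ((mem_invSet σ b a).1 this).2 (not_lt.2 hab.le)
      · exact absurd hab (by simp [h])
      · exact ((mem_invSet τ a b).1 (h₁ ((mem_invSet σ a b).2 ⟨h, hab⟩))).2
    have hmono : StrictMono (fun i => τ.symm (σ i)) := by
      intro i j hij
      exact key _ _ (by simpa using hij)
    have hsurj : Function.Surjective (fun i => τ.symm (σ i)) :=
      τ.symm.surjective.comp σ.surjective
    have hid : hmono.orderIsoOfSurjective _ hsurj = OrderIso.refl (Fin n) :=
      Subsingleton.elim _ _
    ext1 i
    have : τ.symm (σ i) = i := by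
      have := congrArg (fun e => e i) hid
      simpa using this
    exact (Equiv.symm_apply_eq τ).1 this

theorem weakOrder_le_iff {n : ℕ} (σ τ : Equiv.Perm (Fin n)) :
    σ ≤ τ ↔ ∀ a b : Fin n, a < b → σ.symm b < σ.symm a → τ.symm b < τ.symm a := by
  constructor
  · intro h a b hab h1
    exact ((mem_invSet τ b a).1 (h ((mem_invSet σ b a).2 ⟨hab, h1⟩))).2
  · rintro h ⟨b, a⟩ hp
    have := (mem_invSet σ b a).1 hp
    exact (mem_invSet τ b a).2 ⟨this.1, h a b this.1 this.2⟩

/-- A transitive and cotransitive set of pairs is an inversion set. -/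
theorem exists_perm_of_biclosed {n : ℕ} (T : Fin n → Fin n → Prop)
    (hgt : ∀ {b a}, T b a → a < b)
    (htrans : ∀ {c b a}, T c b → T b a → T c a)
    (hco : ∀ {c b a}, T c a → a < b → b < c → T c b ∨ T b a) :
    ∃ ρ : Equiv.Perm (Fin n), ∀ a b : Fin n, a < b → (ρ.symm b < ρ.symm a ↔ T b a) := by
  classical
  let r : Fin n → Fin n → Prop := fun u v => T u v ∨ (u < v ∧ ¬ T v u)
  have hirr : ∀ u, ¬ r u u := by
    rintro u (h | h)
    · exact (hgt h).false
    · exact h.1.false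
  have htr : ∀ u v w, r u v → r v w → r u w := by
    rintro u v w (h | ⟨h, h'⟩) (k | ⟨k, k'⟩)
    · exact Or.inl (htrans h k)
    · rcases lt_trichotomy u w with e | e | e
      · exact Or.inr ⟨e, fun q => k' (htrans q h)⟩
      · subst e; exact absurd h k'
      · exact Or.inl ((hco h k e).resolve_right k' |> fun q => q)
    · rcases lt_trichotomy u w with e | e | e
      · exact Or.inr ⟨e, fun q => h' (htrans k q)⟩
      · subst e; exact absurd k h'
      · exact Or.inl ((hco k e h).resolve_left h')
    · exact Or.inr ⟨h.trans k, fun q => (hco q h k).elim k' h'⟩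
  have htri : ∀ u v, r u v ∨ u = v ∨ r v u := by
    intro u v
    rcases lt_trichotomy u v with e | e | e
    · by_cases q : T v u
      · exact Or.inr (Or.inr (Or.inl q))
      · exact Or.inl (Or.inr ⟨e, q⟩)
    · exact Or.inr (Or.inl e)
    · by_cases q : T u v
      · exact Or.inl (Or.inl q)
      · exact Or.inr (Or.inr (Or.inr ⟨e, q⟩))
  have : IsStrictTotalOrder (Fin n) r :=
    { irrefl := hirr
      trans := htr
      trichotomous := fun u v h₁ h₂ => by
        rcases htri u v with h | h | h
        · exact absurd h h₁
        · exact h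
        · exact absurd h h₂ }
  let L : LinearOrder (Fin n) := linearOrderOfSTO r
  let e := @Fintype.orderIsoFinOfCardEq (Fin n) L _ n (Fintype.card_fin n)
  refine ⟨e.toEquiv, fun a b hab => ?_⟩
  have h1 : e.toEquiv.symm b < e.toEquiv.symm a ↔ r b a :=
    @OrderIso.lt_iff_lt (Fin n) (Fin n) L.toPreorder _ (@OrderIso.symm _ _ _ L.toLE e) b a
  rw [h1]
  exact ⟨fun h => h.resolve_right fun q => (hab.trans q.1).false, Or.inl⟩

theorem exists_isLUB_weakOrder {n : ℕ} (σ τ : Equiv.Perm (Fin n)) :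
    ∃ ρ : Equiv.Perm (Fin n), IsLUB {σ, τ} ρ := by
  let R : Fin n → Fin n → Prop := fun b a =>
    a < b ∧ (σ.symm b < σ.symm a ∨ τ.symm b < τ.symm a)
  have hgt : ∀ {b a}, Relation.TransGen R b a → a < b := by
    intro b a h
    induction h with
    | single h => exact h.1
    | tail _ h ih => exact h.1.trans ih
  have hcoR : ∀ {c b a}, R c a → a < b → b < c → R c b ∨ R b a := by
    rintro c b a ⟨_, h⟩ hab hbc
    rcases h with h | h
    · rcases lt_or_ge (σ.symm c) (σ.symm b) with q | q
      · exact Or.inl ⟨hbc, Or.inl q⟩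
      · exact Or.inr ⟨hab, Or.inl (lt_of_le_of_lt q h)⟩
    · rcases lt_or_ge (τ.symm c) (τ.symm b) with q | q
      · exact Or.inl ⟨hbc, Or.inr q⟩
      · exact Or.inr ⟨hab, Or.inr (lt_of_le_of_lt q h)⟩
  have hco : ∀ {c b a}, Relation.TransGen R c a → a < b → b < c →
      Relation.TransGen R c b ∨ Relation.TransGen R b a := by
    intro c b a h
    induction h with
    | single h =>
      intro h1 h2
      exact (hcoR h h1 h2).imp Relation.TransGen.single Relation.TransGen.single
    | @tail x a hx h ih =>
      intro h1 h2
      rcases lt_trichotomy b x with q | q | q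
      · rcases hcoR h h1 q with k | k
        · exact Or.inl (hx.tail k)
        · exact Or.inr (.single k)
      · subst q; exact Or.inl hx
      · exact (ih q h2).imp id fun k => k.tail h
  obtain ⟨ρ, hρ⟩ := exists_perm_of_biclosed (Relation.TransGen R) hgt
    (fun h k => h.trans k) hco
  refine ⟨ρ, ?_, ?_⟩
  · rintro x (rfl | rfl)
    · exact (weakOrder_le_iff _ _).2 fun a b hab h =>
        (hρ a b hab).2 (.single ⟨hab, Or.inl h⟩)
    · exact (weakOrder_le_iff _ _).2 fun a b hab h =>
        (hρ a b hab).2 (.single ⟨hab, Or.inr h⟩)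
  · intro x hx
    have h1 := (weakOrder_le_iff _ _).1 (hx (Or.inl rfl))
    have h2 := (weakOrder_le_iff _ _).1 (hx (Or.inr rfl))
    have key : ∀ b a, Relation.TransGen R b a → x.symm b < x.symm a := by
      intro b a h
      induction h with
      | single h => exact h.2.elim (h1 _ _ h.1) (h2 _ _ h.1)
      | tail _ h ih => exact ih.trans (h.2.elim (h1 _ _ h.1) (h2 _ _ h.1))
    exact (weakOrder_le_iff _ _).2 fun a b hab h => key b a ((hρ a b hab).1 h)

/-- Reversing words is an order-reversing involution of the weak order. -/
theorem weakOrder_rev_le_iff {n : ℕ} (σ τ : Equiv.Perm (Fin n)) :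
    Fin.revPerm.trans σ ≤ Fin.revPerm.trans τ ↔ τ ≤ σ := by
  have hlt : ∀ (ρ : Equiv.Perm (Fin n)) (a b : Fin n),
      (Fin.revPerm.trans ρ).symm b < (Fin.revPerm.trans ρ).symm a ↔ ρ.symm a < ρ.symm b := by
    intro ρ a b
    simp
  simp only [weakOrder_le_iff, hlt]
  constructor
  · intro h a b hab h1
    by_contra hc
    have hne : σ.symm a ≠ σ.symm b := fun e => hab.ne (σ.symm.injective e)
    exact absurd (h a b hab (lt_of_le_of_ne (not_lt.1 hc) hne)) (not_lt.2 h1.le)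
  · intro h a b hab h1
    by_contra hc
    have hne : τ.symm b ≠ τ.symm a := fun e => hab.ne' (τ.symm.injective e)
    exact absurd (h a b hab (lt_of_le_of_ne (not_lt.1 hc) hne)) (not_lt.2 h1.le)

theorem exists_isGLB_weakOrder {n : ℕ} (σ τ : Equiv.Perm (Fin n)) :
    ∃ ρ : Equiv.Perm (Fin n), IsGLB {σ, τ} ρ := by
  have hinv : ∀ x : Equiv.Perm (Fin n), Fin.revPerm.trans (Fin.revPerm.trans x) = x := by
    intro x
    ext i
    simp
  obtain ⟨ρ, h1, h2⟩ := exists_isLUB_weakOrder (Fin.revPerm.trans σ) (Fin.revPerm.trans τ)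
  refine ⟨Fin.revPerm.trans ρ, ?_, ?_⟩
  · rintro x (rfl | rfl)
    · rw [← weakOrder_rev_le_iff, hinv]; exact h1 (Or.inl rfl)
    · rw [← weakOrder_rev_le_iff, hinv]; exact h1 (Or.inr rfl)
  · intro x hx
    rw [← weakOrder_rev_le_iff, hinv]
    apply h2
    rintro y (rfl | rfl)
    · rw [weakOrder_rev_le_iff]; exact hx (Or.inl rfl)
    · rw [weakOrder_rev_le_iff]; exact hx (Or.inr rfl)

/-- The weak order is a lattice. -/
noncomputable instance weakLattice (n : ℕ) : Lattice (Equiv.Perm (Fin n)) where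
  __ := weakOrder n
  sup σ τ := (exists_isLUB_weakOrder σ τ).choose
  le_sup_left σ τ := (exists_isLUB_weakOrder σ τ).choose_spec.1 (Or.inl rfl)
  le_sup_right σ τ := (exists_isLUB_weakOrder σ τ).choose_spec.1 (Or.inr rfl)
  sup_le σ τ ρ h₁ h₂ := (exists_isLUB_weakOrder σ τ).choose_spec.2 (by
    rintro x (rfl | rfl)
    exacts [h₁, h₂])
  inf σ τ := (exists_isGLB_weakOrder σ τ).choose
  inf_le_left σ τ := (exists_isGLB_weakOrder σ τ).choose_spec.1 (Or.inl rfl)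
  inf_le_right σ τ := (exists_isGLB_weakOrder σ τ).choose_spec.1 (Or.inr rfl)
  le_inf σ τ ρ h₁ h₂ := (exists_isGLB_weakOrder τ ρ).choose_spec.2 (by
    rintro x (rfl | rfl)
    exacts [h₁, h₂])

/-! ### Arcs and noncrossing arc diagrams -/

/-- An arc `(a, b, n, S)` with `a < b` in `[n]` and `S ⊆ ]a,b[`. -/
structure Arc (n : ℕ) where
  left : Fin n
  right : Fin n
  above : Finset (Fin n)
  lt : left < right
  subset : above ⊆ Ioo left right

theorem Arc.ext_fields {n : ℕ} {α β : Arc n} (h₁ : α.left = β.left) (h₂ : α.right = β.right)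
    (h₃ : α.above = β.above) : α = β := by
  cases α; cases β; simp_all

noncomputable instance Arc.instDecidableEq (n : ℕ) : DecidableEq (Arc n) := Classical.decEq _

noncomputable instance Arc.instFintype (n : ℕ) : Fintype (Arc n) :=
  Fintype.ofInjective (fun α : Arc n => (α.left, α.right, α.above)) (fun α β h => by
    simp only [Prod.mk.injEq] at h
    exact Arc.ext_fields h.1 h.2.1 h.2.2)

/-- The arc `(σ_j, σ_i, n, {σ_k | k < i, σ_k ∈ ]σ_j, σ_i[})` of a pair `(i, j)` of positions with
`σ_j < σ_i`. -/
def arcOf {n : ℕ} (σ : Equiv.Perm (Fin n)) (i j : Fin n) (h : σ j < σ i) : Arc n where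
  left := σ j
  right := σ i
  above := (Ioo (σ j) (σ i)).filter fun v => σ.symm v < i
  lt := h
  subset := filter_subset _ _

open Classical in
/-- `δ(σ)`: the set of arcs of all descents `σ_i > σ_{i+1}` of `σ`. -/
noncomputable def descentDiagram {n : ℕ} (σ : Equiv.Perm (Fin n)) : Finset (Arc n) :=
  univ.filter fun α => ∃ (i j : Fin n) (h : σ j < σ i), (j : ℕ) = i + 1 ∧ α = arcOf σ i j h

/-- Two arcs `(a, b, n, R)` and `(c, d, n, S)` cross if each of them is, at some point of
`([a,b] ∩ [c,d]) \ ({a,b} ∩ {c,d})`, above the other one. -/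
def Arc.Cross {n : ℕ} (α β : Arc n) : Prop :=
  ∃ r ∈ (Icc α.left α.right ∩ Icc β.left β.right) \
      (({α.left, α.right} : Finset (Fin n)) ∩ {β.left, β.right}),
  ∃ s ∈ (Icc α.left α.right ∩ Icc β.left β.right) \
      (({α.left, α.right} : Finset (Fin n)) ∩ {β.left, β.right}),
    r ∈ (α.above ∪ {α.left, α.right}) \ β.above ∧
    s ∈ (β.above ∪ {β.left, β.right}) \ α.above

/-- Noncrossing arc diagrams: any two distinct arcs do not cross, and have distinct left endpoints
and distinct right endpoints. -/
def IsNoncrossing {n : ℕ} (D : Finset (Arc n)) : Prop :=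
  ∀ α ∈ D, ∀ β ∈ D, α ≠ β → ¬ α.Cross β ∧ α.left ≠ β.left ∧ α.right ≠ β.right

/-! ### Arc ideals and lattice congruences of the weak order -/

/-- The restriction `(b, c, n, S ∩ ]b,c[)` of an arc `(a, d, n, S)`. -/
def Arc.restrict {n : ℕ} (α : Arc n) (b c : Fin n) (h : b < c) : Arc n where
  left := b
  right := c
  above := α.above ∩ Ioo b c
  lt := h
  subset := inter_subset_right

/-- Arc ideals: sets of arcs containing, with an arc `(a, d, n, S)`, all its restrictions
to `[b, c]` for `a ≤ b < c ≤ d`. -/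
structure ArcIdeal (n : ℕ) where
  carrier : Set (Arc n)
  restrict_mem : ∀ α ∈ carrier, ∀ (b c : Fin n) (h : b < c), α.left ≤ b → c ≤ α.right →
    α.restrict b c h ∈ carrier

open Classical in
/-- The bottom element of the class of `σ` for a lattice congruence of the weak order, as the meet
of that (finite) class. -/
noncomputable def projDown {n : ℕ} (r : LatticeCon (Equiv.Perm (Fin n)))
    (σ : Equiv.Perm (Fin n)) : Equiv.Perm (Fin n) :=
  (univ.filter fun τ => r.r σ τ).inf' ⟨σ, by simp⟩ id

/-- The arcs `δ(σ) = {α}` of the join-irreducible permutations `σ` (those covering exactly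
one element) that are not contracted by `r`. -/
def uncontractedArcs {n : ℕ} (r : LatticeCon (Equiv.Perm (Fin n))) : Set (Arc n) :=
  {α | ∃ σ : Equiv.Perm (Fin n), (∃! τ, τ ⋖ σ) ∧ projDown r σ = σ ∧ descentDiagram σ = {α}}

/-- The lattice congruence of the weak order whose set of uncontracted arcs is the arc ideal `I`
(there is exactly one; it is written as the intersection of all of them). -/
def arcCongruence {n : ℕ} (I : ArcIdeal n) : LatticeCon (Equiv.Perm (Fin n)) where
  r σ τ := ∀ r : LatticeCon (Equiv.Perm (Fin n)), uncontractedArcs r = I.carrier → r.r σ τ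
  iseqv :=
    { refl := fun σ r _ => r.iseqv.refl σ
      symm := fun h r hr => r.iseqv.symm (h r hr)
      trans := fun h h' r hr => r.iseqv.trans (h r hr) (h' r hr) }
  inf h h' r hr := r.inf (h r hr) (h' r hr)
  sup h h' r hr := r.sup (h r hr) (h' r hr)

/-- The surjection `η_I(σ) = δ(π_↓(σ))` onto the noncrossing arc diagrams in `I`. -/
noncomputable def eta {n : ℕ} (I : ArcIdeal n) (σ : Equiv.Perm (Fin n)) : Finset (Arc n) :=
  descentDiagram (projDown (arcCongruence I) σ)

/-- The order of the lattice of noncrossing arc diagrams in `I`, i.e. of the lattice quotient of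
the weak order: two classes are comparable if some of their representatives are. -/
def DiagramLE {n : ℕ} (I : ArcIdeal n) (D E : Finset (Arc n)) : Prop :=
  ∃ σ τ : Equiv.Perm (Fin n), eta I σ = D ∧ eta I τ = E ∧ σ ≤ τ

open Classical in
/-- The interval between `L` and `U` in the lattice of noncrossing arc diagrams in `I`. -/
noncomputable def diagramInterval {n : ℕ} (I : ArcIdeal n) (L U : Finset (Arc n)) :
    Finset (Finset (Arc n)) :=
  univ.filter fun F => IsNoncrossing F ∧ (F : Set (Arc n)) ⊆ I.carrier ∧
    DiagramLE I L F ∧ DiagramLE I F U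

/-! ### Decoration sets and conservative functions -/

theorem card_union_shift {m n k l : ℕ} {R : Finset (Fin m)} (hR : R.card = k)
    {S : Finset (Fin n)} (hS : S.card = l) :
    (R.map (Fin.castAddEmb n) ∪ S.map (Fin.natAddEmb m)).card = k + l := by
  rw [card_union_of_disjoint, card_map, card_map, hR, hS]
  rw [disjoint_left]
  intro x hx hy
  obtain ⟨a, _, rfl⟩ := mem_map.1 hx
  obtain ⟨b, _, h⟩ := mem_map.1 hy
  have := congrArg Fin.val h
  simp at this
  omega

/-- A decoration set: a graded set with an associative concatenation and a compatible selection.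
For `R = {r_1 < ⋯ < r_q}`, the element `r_s` is `R.orderEmbOfFin hR s`. -/
structure DecorationSet where
  carrier : ℕ → Type u
  concat : ∀ {m n : ℕ}, carrier m → carrier n → carrier (m + n)
  select : ∀ {m k : ℕ}, carrier m → ∀ R : Finset (Fin m), R.card = k → carrier k
  concat_assoc : ∀ {m n p : ℕ} (X : carrier m) (Y : carrier n) (Z : carrier p),
    HEq (concat X (concat Y Z)) (concat (concat X Y) Z)
  select_select : ∀ {p q k : ℕ} (X : carrier p) (R : Finset (Fin p)) (hR : R.card = q)
    (S : Finset (Fin q)) (hS : S.card = k),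
    select (select X R hR) S hS =
      select X (S.map (R.orderEmbOfFin hR).toEmbedding) ((card_map _).trans hS)
  concat_select : ∀ {m n k l : ℕ} (X : carrier m) (Y : carrier n)
    (R : Finset (Fin m)) (hR : R.card = k) (S : Finset (Fin n)) (hS : S.card = l),
    concat (select X R hR) (select Y S hS) =
      select (concat X Y) (R.map (Fin.castAddEmb n) ∪ S.map (Fin.natAddEmb m))
        (card_union_shift hR hS)

/-- The augmented arc `(a, b, m + n, S)`. -/
def Arc.augment {m : ℕ} (α : Arc m) (n : ℕ) : Arc (m + n) where
  left := Fin.castAdd n α.left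
  right := Fin.castAdd n α.right
  above := α.above.map (Fin.castAddEmb n)
  lt := α.lt
  subset := by
    intro x hx
    obtain ⟨y, hy, rfl⟩ := mem_map.1 hx
    have h := mem_Ioo.1 (α.subset hy)
    exact mem_Ioo.2 ⟨h.1, h.2⟩

/-- The shifted arc `(a + m, b + m, m + n, {s + m | s ∈ S})`. -/
def Arc.shift {n : ℕ} (α : Arc n) (m : ℕ) : Arc (m + n) where
  left := Fin.natAdd m α.left
  right := Fin.natAdd m α.right
  above := α.above.map (Fin.natAddEmb m)
  lt := by simpa using α.lt
  subset := by
    intro x hx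
    obtain ⟨y, hy, rfl⟩ := mem_map.1 hx
    simpa using α.subset hy

/-- The arc `(a, b, q, {c ∈ [q] | r_c ∈ S})` obtained from `(r_a, r_b, p, S)`. -/
def selectArc {p q : ℕ} (r : Fin q ↪o Fin p) (a b : Fin q) (hab : a < b)
    (S : Finset (Fin p)) (hS : S ⊆ Ioo (r a) (r b)) : Arc q where
  left := a
  right := b
  above := univ.filter fun c => r c ∈ S
  lt := hab
  subset := by
    intro c hc
    simpa using hS (mem_filter.1 hc).2

/-- A conservative function from a decoration set to arc ideals. -/
structure ConservativeFunction (𝔛 : DecorationSet.{u}) where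
  arcs : ∀ {n : ℕ}, 𝔛.carrier n → ArcIdeal n
  augment_mem : ∀ {m n : ℕ} (X : 𝔛.carrier m) (Y : 𝔛.carrier n),
    ∀ α ∈ (arcs X).carrier, α.augment n ∈ (arcs (𝔛.concat X Y)).carrier
  shift_mem : ∀ {m n : ℕ} (X : 𝔛.carrier m) (Y : 𝔛.carrier n),
    ∀ α ∈ (arcs Y).carrier, α.shift m ∈ (arcs (𝔛.concat X Y)).carrier
  select_mem : ∀ {p q : ℕ} (Z : 𝔛.carrier p) (R : Finset (Fin p)) (hR : R.card = q)
    (a b : Fin q) (hab : a < b) (S : Finset (Fin p))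
    (hS : S ⊆ Ioo (R.orderEmbOfFin hR a) (R.orderEmbOfFin hR b)),
    (⟨R.orderEmbOfFin hR a, R.orderEmbOfFin hR b, S,
        (R.orderEmbOfFin hR).lt_iff_lt.2 hab, hS⟩ : Arc p) ∈ (arcs Z).carrier →
      selectArc (R.orderEmbOfFin hR) a b hab S hS ∈ (arcs (𝔛.select Z R hR)).carrier

/-! ### The algebra of decorated permutations -/

/-- The standardization of the word obtained from `ρ` by deleting the entries whose values are not
in `R`: the `i`-th remaining position is sent to the rank in `R` of the entry there. -/
def stdVal {p q : ℕ} (ρ : Equiv.Perm (Fin p)) (R : Finset (Fin p)) (hR : R.card = q) :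
    Equiv.Perm (Fin q) :=
  (((R.map ρ.symm.toEmbedding).orderIsoOfFin ((card_map _).trans hR)).toEquiv.trans
    (ρ.subtypeEquiv fun a => by simp)).trans
      (R.orderIsoOfFin hR).toEquiv.symm

/-- The shifted shuffle of `σ` and `τ`: the permutations of `[m+n]` whose standardization
on the values `[m]` is `σ` and whose standardization on the values `[m+n] \ [m]` is `τ`. -/
def shiftedShuffle {m n : ℕ} (σ : Equiv.Perm (Fin m)) (τ : Equiv.Perm (Fin n)) :
    Finset (Equiv.Perm (Fin (m + n))) :=
  univ.filter fun ρ =>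
    stdVal ρ (univ.map (Fin.castAddEmb n)) (by simp) = σ ∧
    stdVal ρ (univ.map (Fin.natAddEmb m)) (by simp) = τ

/-- `σ \ τ`, the word `σ_1 … σ_m (m + τ_1) … (m + τ_n)`. -/
def backslash {m n : ℕ} (σ : Equiv.Perm (Fin m)) (τ : Equiv.Perm (Fin n)) :
    Equiv.Perm (Fin (m + n)) :=
  (finSumFinEquiv.symm.trans (Equiv.sumCongr σ τ)).trans finSumFinEquiv

/-- `τ / σ`, the word `(m + τ_1) … (m + τ_n) σ_1 … σ_m`. -/
def slash {m n : ℕ} (τ : Equiv.Perm (Fin n)) (σ : Equiv.Perm (Fin m)) :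
    Equiv.Perm (Fin (m + n)) :=
  ((((finCongr (Nat.add_comm m n)).trans finSumFinEquiv.symm).trans
    (Equiv.sumComm (Fin n) (Fin m))).trans (Equiv.sumCongr σ τ)).trans finSumFinEquiv

/-- Decorated permutations of arbitrary size. -/
abbrev DecPerm (𝔛 : DecorationSet.{u}) : Type u :=
  Σ n : ℕ, Equiv.Perm (Fin n) × 𝔛.carrier n

/-- The vector space with basis the decorated permutations. -/
abbrev DecPermSpace (k : Type v) [Field k] (𝔛 : DecorationSet.{u}) : Type (max u v) :=
  DecPerm 𝔛 →₀ k

/-- The basis vector `F_(σ, X)`. -/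
noncomputable def basisF (k : Type v) [Field k] (𝔛 : DecorationSet.{u}) {n : ℕ}
    (σ : Equiv.Perm (Fin n)) (X : 𝔛.carrier n) : DecPermSpace k 𝔛 :=
  Finsupp.single ⟨n, σ, X⟩ 1

/-- The product: the bilinear extension of
`F_(σ,X) · F_(τ,Y) = ∑ F_(ρ, X·Y)` over the shifted shuffle of `σ` and `τ`. -/
noncomputable def product (k : Type v) [Field k] (𝔛 : DecorationSet.{u}) :
    DecPermSpace k 𝔛 →ₗ[k] DecPermSpace k 𝔛 →ₗ[k] DecPermSpace k 𝔛 :=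
  Finsupp.linearCombination k fun p : DecPerm 𝔛 =>
    Finsupp.linearCombination k fun q : DecPerm 𝔛 =>
      ∑ ρ ∈ shiftedShuffle p.2.1 q.2.1, basisF k 𝔛 ρ (𝔛.concat p.2.2 q.2.2)

open Classical in
/-- `P_(D, X)`: the sum of `F_(σ, X)` over the permutations `σ` with `η_{arcs(X)}(σ) = D`. -/
noncomputable def basisP (k : Type v) [Field k] {𝔛 : DecorationSet.{u}}
    (A : ConservativeFunction 𝔛) {n : ℕ} (D : Finset (Arc n)) (X : 𝔛.carrier n) :
    DecPermSpace k 𝔛 :=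
  ∑ σ ∈ univ.filter (fun σ : Equiv.Perm (Fin n) => eta (A.arcs X) σ = D), basisF k 𝔛 σ X

end ArcHopf

namespace ArcHopf

open Finset

/-! ### Join-irreducible and meet-irreducible permutations of an arc -/

/-! Each permutation `ρ` of `[m+n]` lies in exactly one shifted shuffle, that of its
standardizations on the small values `[m]` and on the large values. So the product is the sum of the
basis vectors of those `ρ` whose two standardizations lie in `[μ,ν]` and `[λ,ω]`. A mixed pair of
values is never inverted in `μ\λ` and always inverted in `ω/ν`, while the other pairs are inverted
as in the two factors. Hence these `ρ` are exactly the weak order interval `[μ\λ, ω/ν]`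
(`backslash_le_iff`, `le_slash_iff`).

The right side is the sum over the preimage under `eta` of an interval of the quotient. When the
lower end comes from the bottom of a class and the upper end from the top of a class, that preimage
is the weak order interval between them (`eta_mem_diagramInterval_iff`). It remains to see that
`μ\λ` is a bottom and `ω/ν` a top. A permutation is the bottom of its class exactly when its descent
arcs all lie in the ideal (`projDown_con_eq_self_iff`). The descents of `σ\τ` are those of `σ`,
augmented, and those of `τ`, shifted, so condition (i) of a conservative function settles the
bottom. Tops become bottoms on reversing words and complementing arcs, and reversal sends `ω/ν` to a
backslash product.

All this needs an explicit form of the congruence. Two permutations are congruent when the same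
join-irreducibles of arcs of `I` lie below them. Closure of `I` under restriction gives the dual
description by meet-irreducibles (`ArcIdeal.Le.above`), so the relation respects both meets and
joins. Any congruence with uncontracted arcs `I` equals this one (`arcCongruence_rel_iff`). Finally,
every noncrossing diagram is a descent diagram (`exists_descentDiagram_eq`), so the fibers are
nonempty. -/

/-- All values of `{b} ∪ S` come before all smaller values of `{a} ∪ (]a,b[ \ S)`. -/
def Arc.Below {n : ℕ} (α : Arc n) (σ : Equiv.Perm (Fin n)) : Prop :=
  ∀ x y : Fin n, α.left ≤ x → x < y → y ≤ α.right → x ∉ α.above →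
    (y ∈ α.above ∨ y = α.right) → σ.symm y < σ.symm x

/-- All values of `{a} ∪ S` come before all larger values of `{b} ∪ (]a,b[ \ S)`. -/
def Arc.Above {n : ℕ} (α : Arc n) (σ : Equiv.Perm (Fin n)) : Prop :=
  ∀ x y : Fin n, α.left ≤ x → x < y → y ≤ α.right → (x ∈ α.above ∨ x = α.left) →
    y ∉ α.above → σ.symm x < σ.symm y

theorem Arc.lt_of_mem {n : ℕ} {α : Arc n} {x : Fin n} (h : x ∈ α.above) :
    α.left < x ∧ x < α.right :=
  mem_Ioo.1 (α.subset h)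

theorem Arc.left_notMem {n : ℕ} (α : Arc n) : α.left ∉ α.above :=
  fun h => (Arc.lt_of_mem h).1.false

theorem Arc.right_notMem {n : ℕ} (α : Arc n) : α.right ∉ α.above :=
  fun h => (Arc.lt_of_mem h).2.false

/-- The complementary arc `(a, b, n, ]a,b[ \ S)`. -/
def Arc.compl {n : ℕ} (α : Arc n) : Arc n where
  left := α.left
  right := α.right
  above := Ioo α.left α.right \ α.above
  lt := α.lt
  subset := sdiff_subset

theorem Arc.compl_compl {n : ℕ} (α : Arc n) : α.compl.compl = α := by
  refine Arc.ext_fields rfl rfl ?_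
  simp only [Arc.compl]
  exact Finset.sdiff_sdiff_eq_self α.subset

theorem symm_revPerm_trans {n : ℕ} (σ : Equiv.Perm (Fin n)) (a : Fin n) :
    (Fin.revPerm.trans σ).symm a = Fin.rev (σ.symm a) := by
  simp

theorem revPerm_trans_trans {n : ℕ} (σ : Equiv.Perm (Fin n)) :
    Fin.revPerm.trans (Fin.revPerm.trans σ) = σ := by
  ext i
  simp

/-- Reversal flips all position comparisons, and inside `[a,b]` the two conditions on `x` and `y`
are exchanged, up to negation, by complementing `S`. This duality later turns statements about joins
and tops into statements about meets and bottoms. -/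
theorem Arc.above_iff_below_rev {n : ℕ} (α : Arc n) (σ : Equiv.Perm (Fin n)) :
    α.Above σ ↔ α.compl.Below (Fin.revPerm.trans σ) := by
  simp only [Arc.Above, Arc.Below, symm_revPerm_trans, Fin.rev_lt_rev, Arc.compl, mem_sdiff,
    mem_Ioo]
  refine forall₂_congr fun x y => forall₃_congr fun h1 h2 h3 => ?_
  have hx : (x ∈ α.above ∨ x = α.left) ↔ ¬((α.left < x ∧ x < α.right) ∧ x ∉ α.above) := by
    rcases h1.lt_or_eq with h | h
    · have := h2.trans_le h3
      simp [h, this, h.ne']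
    · simp [← h]
  have hy : y ∉ α.above ↔ ((α.left < y ∧ y < α.right) ∧ y ∉ α.above) ∨ y = α.right := by
    rcases h3.lt_or_eq with h | h
    · have := h1.trans_lt h2
      simp [h, this, h.ne]
    · simp [h, α.right_notMem]
  exact imp_congr hx (imp_congr hy Iff.rfl)

theorem Arc.below_iff_above_rev {n : ℕ} (α : Arc n) (σ : Equiv.Perm (Fin n)) :
    α.Below σ ↔ α.compl.Above (Fin.revPerm.trans σ) := by
  rw [Arc.above_iff_below_rev, Arc.compl_compl, revPerm_trans_trans]

/-- The pairs of values inverted in the join-irreducible permutation of an arc. -/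
def Arc.Inv {n : ℕ} (α : Arc n) (y x : Fin n) : Prop :=
  α.left ≤ x ∧ x < y ∧ y ≤ α.right ∧ x ∉ α.above ∧ (y ∈ α.above ∨ y = α.right)

theorem Arc.below_iff {n : ℕ} (α : Arc n) (σ : Equiv.Perm (Fin n)) :
    α.Below σ ↔ ∀ y x, α.Inv y x → σ.symm y < σ.symm x :=
  ⟨fun h y x q => h x y q.1 q.2.1 q.2.2.1 q.2.2.2.1 q.2.2.2.2,
    fun h x y h1 h2 h3 h4 h5 => h y x ⟨h1, h2, h3, h4, h5⟩⟩

theorem Arc.inv_right_left {n : ℕ} (α : Arc n) : α.Inv α.right α.left :=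
  ⟨le_rfl, α.lt, le_rfl, α.left_notMem, Or.inr rfl⟩

theorem Arc.Inv.cotrans {n : ℕ} {α : Arc n} {c b a : Fin n} (h : α.Inv c a) (h1 : a < b)
    (h2 : b < c) : α.Inv c b ∨ α.Inv b a := by
  obtain ⟨q1, -, q3, q4, q5⟩ := h
  by_cases hb : b ∈ α.above
  · exact Or.inr ⟨q1, h1, h2.le.trans q3, q4, Or.inl hb⟩
  · exact Or.inl ⟨q1.trans h1.le, h2, q3, hb, q5⟩

/-- Transitivity is vacuous: the middle value of two composable pairs would be outside `S`, hence
equal to `b`, and no larger value is available. -/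
theorem Arc.exists_joinIrr {n : ℕ} (α : Arc n) :
    ∃ ρ : Equiv.Perm (Fin n), ∀ a b : Fin n, a < b → (ρ.symm b < ρ.symm a ↔ α.Inv b a) := by
  refine exists_perm_of_biclosed α.Inv (fun h => h.2.1) ?_ (fun h => h.cotrans)
  rintro c b a ⟨-, h2, h3, h4, -⟩ ⟨-, -, -, -, q5⟩
  rcases q5 with q | q
  · exact absurd q h4
  · exact absurd (q ▸ h2) (not_lt.2 h3)

/-- The join-irreducible permutation of an arc. -/
noncomputable def Arc.joinIrr {n : ℕ} (α : Arc n) : Equiv.Perm (Fin n) := α.exists_joinIrr.choose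

theorem Arc.joinIrr_inv {n : ℕ} (α : Arc n) {a b : Fin n} (h : a < b) :
    α.joinIrr.symm b < α.joinIrr.symm a ↔ α.Inv b a :=
  α.exists_joinIrr.choose_spec a b h

theorem Arc.joinIrr_le_iff {n : ℕ} (α : Arc n) (σ : Equiv.Perm (Fin n)) :
    α.joinIrr ≤ σ ↔ α.Below σ := by
  rw [weakOrder_le_iff, Arc.below_iff]
  exact ⟨fun h y x q => h x y q.2.1 ((α.joinIrr_inv q.2.1).2 q),
    fun h a b hab q => h b a ((α.joinIrr_inv hab).1 q)⟩

theorem Arc.Below.mono {n : ℕ} {α : Arc n} {σ τ : Equiv.Perm (Fin n)} (h : α.Below σ)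
    (hle : σ ≤ τ) : α.Below τ :=
  (α.joinIrr_le_iff τ).1 (((α.joinIrr_le_iff σ).2 h).trans hle)

/-- `Below` cuts out the principal filter of `joinIrr`, so it is compatible with meets. Dually,
`Above` cuts out a principal ideal and is compatible with joins. -/
theorem Arc.below_inf {n : ℕ} (α : Arc n) (σ τ : Equiv.Perm (Fin n)) :
    α.Below (σ ⊓ τ) ↔ α.Below σ ∧ α.Below τ := by
  simp only [← Arc.joinIrr_le_iff]
  exact le_inf_iff

theorem Arc.le_meetIrr_iff {n : ℕ} (α : Arc n) (σ : Equiv.Perm (Fin n)) :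
    σ ≤ Fin.revPerm.trans α.compl.joinIrr ↔ α.Above σ := by
  rw [Arc.above_iff_below_rev, ← Arc.joinIrr_le_iff, ← weakOrder_rev_le_iff, revPerm_trans_trans]

theorem Arc.above_sup {n : ℕ} (α : Arc n) (σ τ : Equiv.Perm (Fin n)) :
    α.Above (σ ⊔ τ) ↔ α.Above σ ∧ α.Above τ := by
  simp only [← Arc.le_meetIrr_iff]
  exact sup_le_iff

/-! ### The preorder of an arc ideal -/

/-- The preorder of an arc ideal `I`: every join-irreducible permutation of an arc of `I` below `σ`
is below `τ`. -/
def ArcIdeal.Le {n : ℕ} (I : ArcIdeal n) (σ τ : Equiv.Perm (Fin n)) : Prop :=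
  ∀ α ∈ I.carrier, α.Below σ → α.Below τ

/-- The ideal of the complements of the arcs of an arc ideal. -/
def ArcIdeal.compl {n : ℕ} (I : ArcIdeal n) : ArcIdeal n where
  carrier := {α | α.compl ∈ I.carrier}
  restrict_mem := by
    intro α hα b c h hb hc
    have : (α.restrict b c h).compl = α.compl.restrict b c h := by
      refine Arc.ext_fields rfl rfl ?_
      ext x
      simp only [Arc.compl, Arc.restrict, mem_sdiff, mem_Ioo, mem_inter]
      constructor
      · rintro ⟨h1, h2⟩
        exact ⟨⟨⟨hb.trans_lt h1.1, h1.2.trans_le hc⟩, fun q => h2 ⟨q, h1⟩⟩, h1⟩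
      · rintro ⟨⟨h1, h2⟩, h3⟩
        exact ⟨h3, fun q => h2 q.1⟩
    change (α.restrict b c h).compl ∈ I.carrier
    rw [this]
    exact I.restrict_mem _ hα b c h hb hc

theorem ArcIdeal.compl_compl {n : ℕ} (I : ArcIdeal n) : I.compl.compl = I := by
  cases I
  simp [ArcIdeal.compl, Arc.compl_compl]

/-- Among the pairs `x < y` at which `σ` violates `Above`, take one with `y - x` minimal. The
restriction of `α` to `[x,y]` is in `I`, and minimality puts its join-irreducible below `σ`, hence
below `τ`. So `τ` also inverts `x` and `y`, against `Above`. -/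
theorem ArcIdeal.Le.above {n : ℕ} {I : ArcIdeal n} {σ τ : Equiv.Perm (Fin n)} (h : I.Le σ τ)
    {α : Arc n} (hα : α ∈ I.carrier) (hτ : α.Above τ) : α.Above σ := by
  by_contra hσ
  have hex : ∃ d : ℕ, ∃ x y : Fin n, (y : ℕ) = x + d ∧ α.left ≤ x ∧ x < y ∧ y ≤ α.right ∧
      (x ∈ α.above ∨ x = α.left) ∧ y ∉ α.above ∧ σ.symm y < σ.symm x := by
    simp only [Arc.Above, not_forall] at hσ
    obtain ⟨x, y, h1, h2, h3, h4, h5, h6⟩ := hσ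
    refine ⟨y - x, x, y, ?_, h1, h2, h3, h4, h5, ?_⟩
    · have : (x : ℕ) < y := h2
      omega
    · exact lt_of_le_of_ne (not_lt.1 h6) fun e => h2.ne' (σ.symm.injective e)
  classical
  obtain ⟨x, y, hd, h1, h2, h3, h4, h5, h6⟩ := Nat.find_spec hex
  have hmin : ∀ x' y' : Fin n, x ≤ x' → x' < y' → y' ≤ y → (x < x' ∨ y' < y) →
      (x' ∈ α.above ∨ x' = α.left) → y' ∉ α.above → σ.symm x' < σ.symm y' := by
    intro x' y' k1 k2 k3 k k4 k5
    by_contra hc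
    have e1 : (x : ℕ) ≤ x' := k1
    have e2 : (x' : ℕ) < y' := k2
    have e3 : (y' : ℕ) ≤ y := k3
    have e4 : (x : ℕ) < x' ∨ (y' : ℕ) < y := k
    refine Nat.find_min hex (m := y' - x') (by omega) ⟨x', y', by omega, h1.trans k1, k2,
      k3.trans h3, k4, k5, ?_⟩
    exact lt_of_le_of_ne (not_lt.1 hc) fun e => k2.ne' (σ.symm.injective e)
  have hβ := I.restrict_mem α hα x y h2 h1 h3
  -- Minimality applied to the pairs `(x,t)` and `(s,y)` gives the order of positions `s ≤ y < x ≤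
  -- t`.
  have key : (α.restrict x y h2).Below σ := by
    intro t s q1 q2 q3 q4 q5
    simp only [Arc.restrict, mem_inter, mem_Ioo] at q1 q3 q4 q5
    have ht : σ.symm x ≤ σ.symm t := by
      rcases q1.lt_or_eq with q | q
      · exact (hmin x t le_rfl q (q2.le.trans q3) (Or.inr (q2.trans_le q3)) h4
          (fun k => q4 ⟨k, q, q2.trans_le q3⟩)).le
      · rw [q]
    have hs : σ.symm s ≤ σ.symm y := by
      rcases q5 with q | q
      · exact (hmin s y q.2.1.le q.2.2 le_rfl (Or.inl q.2.1) (Or.inl q.1) h5).le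
      · rw [q]
    exact (hs.trans_lt h6).trans_le ht
  have k := h _ hβ key x y le_rfl h2 le_rfl (by simp [Arc.restrict]) (Or.inr rfl)
  exact absurd (hτ x y h1 h2 h3 h4 h5) (not_lt.2 k.le)

theorem ArcIdeal.le_rev_iff {n : ℕ} (I : ArcIdeal n) (σ τ : Equiv.Perm (Fin n)) :
    I.compl.Le (Fin.revPerm.trans τ) (Fin.revPerm.trans σ) ↔ I.Le σ τ := by
  have key : ∀ (J : ArcIdeal n) (ρ π : Equiv.Perm (Fin n)), J.Le ρ π →
      J.compl.Le (Fin.revPerm.trans π) (Fin.revPerm.trans ρ) := by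
    intro J ρ π h α hα hb
    rw [Arc.below_iff_above_rev, revPerm_trans_trans] at hb ⊢
    exact h.above hα hb
  refine ⟨fun h => ?_, key I σ τ⟩
  have := key _ _ _ h
  rwa [ArcIdeal.compl_compl, revPerm_trans_trans, revPerm_trans_trans] at this

theorem ArcIdeal.le_iff_above {n : ℕ} (I : ArcIdeal n) (σ τ : Equiv.Perm (Fin n)) :
    I.Le σ τ ↔ ∀ α ∈ I.carrier, α.Above τ → α.Above σ := by
  refine ⟨fun h α hα => h.above hα, fun h => (I.le_rev_iff σ τ).1 fun α hα hb => ?_⟩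
  rw [Arc.below_iff_above_rev, revPerm_trans_trans] at hb ⊢
  exact h _ hα hb

theorem ArcIdeal.le_of_le {n : ℕ} (I : ArcIdeal n) {σ τ : Equiv.Perm (Fin n)} (h : σ ≤ τ) :
    I.Le σ τ :=
  fun _ _ hb => hb.mono h

theorem ArcIdeal.Le.trans {n : ℕ} {I : ArcIdeal n} {σ τ ρ : Equiv.Perm (Fin n)} (h : I.Le σ τ)
    (h' : I.Le τ ρ) : I.Le σ ρ :=
  fun α hα hb => h' α hα (h α hα hb)

/-- The lattice congruence of the preorder of an arc ideal. -/
def ArcIdeal.con {n : ℕ} (I : ArcIdeal n) : LatticeCon (Equiv.Perm (Fin n)) where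
  r σ τ := I.Le σ τ ∧ I.Le τ σ
  iseqv :=
    { refl := fun σ => ⟨I.le_of_le le_rfl, I.le_of_le le_rfl⟩
      symm := And.symm
      trans := fun h h' => ⟨h.1.trans h'.1, h'.2.trans h.2⟩ }
  inf := by
    intro w x y z h h'
    constructor <;> intro α hα <;> simp only [Arc.below_inf]
    · exact And.imp (h.1 α hα) (h'.1 α hα)
    · exact And.imp (h.2 α hα) (h'.2 α hα)
  sup := by
    intro w x y z h h'
    simp only [ArcIdeal.le_iff_above] at h h' ⊢
    constructor <;> intro α hα <;> simp only [Arc.above_sup]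
    · exact And.imp (h.1 α hα) (h'.1 α hα)
    · exact And.imp (h.2 α hα) (h'.2 α hα)

/-! ### Descents and noncrossing arc diagrams -/

theorem mem_descentDiagram {n : ℕ} (σ : Equiv.Perm (Fin n)) (α : Arc n) :
    α ∈ descentDiagram σ ↔ (σ.symm α.left : ℕ) = σ.symm α.right + 1 ∧
      α.above = (Ioo α.left α.right).filter fun v => σ.symm v < σ.symm α.right := by
  simp only [descentDiagram, mem_filter, mem_univ, true_and]
  constructor
  · rintro ⟨i, j, h, hij, rfl⟩
    simp [arcOf, hij]
  · rintro ⟨h1, h2⟩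
    refine ⟨σ.symm α.right, σ.symm α.left, by simpa using α.lt, h1, ?_⟩
    refine Arc.ext_fields (by simp [arcOf]) (by simp [arcOf]) ?_
    simpa [arcOf] using h2

theorem exists_mem_descentDiagram {n : ℕ} (σ : Equiv.Perm (Fin n)) {x y : Fin n} (hxy : x < y)
    (h : (σ.symm x : ℕ) = σ.symm y + 1) :
    ∃ α ∈ descentDiagram σ, α.left = x ∧ α.right = y :=
  ⟨⟨x, y, (Ioo x y).filter fun v => σ.symm v < σ.symm y, hxy, filter_subset _ _⟩,
    (mem_descentDiagram _ _).2 ⟨h, rfl⟩, rfl, rfl⟩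

section Descent

variable {n : ℕ} {σ : Equiv.Perm (Fin n)} {α : Arc n}

theorem descent_lt (hα : α ∈ descentDiagram σ) : σ.symm α.right < σ.symm α.left := by
  have := ((mem_descentDiagram σ α).1 hα).1
  rw [Fin.lt_def]
  omega

theorem descent_mem_above (hα : α ∈ descentDiagram σ) {v : Fin n} (h1 : α.left < v)
    (h2 : v < α.right) : v ∈ α.above ↔ σ.symm v < σ.symm α.right := by
  rw [((mem_descentDiagram σ α).1 hα).2]
  simp [h1, h2]

theorem descent_lt_left_iff (hα : α ∈ descentDiagram σ) (v : Fin n) :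
    σ.symm v < σ.symm α.left ↔ σ.symm v ≤ σ.symm α.right := by
  have := ((mem_descentDiagram σ α).1 hα).1
  rw [Fin.lt_def, Fin.le_def]
  omega

/-- The values of `S ∪ {b}` stand at or before the position of `b`, and the other values of `[a,b]`
at or after that of `a`, which comes next. -/
theorem below_of_mem_descentDiagram (hα : α ∈ descentDiagram σ) : α.Below σ := by
  intro x y h1 h2 h3 h4 h5
  have hy : σ.symm y ≤ σ.symm α.right := by
    rcases h5 with h | h
    · exact ((descent_mem_above hα (h1.trans_lt h2) (Arc.lt_of_mem h).2).1 h).le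
    · rw [h]
  have hx : σ.symm α.left ≤ σ.symm x := by
    rcases h1.lt_or_eq with h | h
    · have hne := h2.trans_le h3
      have h' := mt (descent_mem_above hα h hne).2 h4
      by_contra hc
      rw [not_le, descent_lt_left_iff hα] at hc
      exact hne.ne (σ.symm.injective (le_antisymm hc (not_lt.1 h')))
    · rw [h]
  exact (hy.trans_lt (descent_lt hα)).trans_le hx

/-- Removing a descent from the inversions gives an element covered by the permutation. -/
theorem exists_remove_descent (hα : α ∈ descentDiagram σ) :
    ∃ ρ : Equiv.Perm (Fin n), ∀ x y : Fin n, x < y → (ρ.symm y < ρ.symm x ↔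
      σ.symm y < σ.symm x ∧ ¬ (y = α.right ∧ x = α.left)) := by
  -- Both closure conditions for `T` survive the removal of one pair because no entry stands between
  -- the two ends of a descent.
  let T : Fin n → Fin n → Prop := fun y x =>
    x < y ∧ σ.symm y < σ.symm x ∧ ¬ (y = α.right ∧ x = α.left)
  have htrans : ∀ {c b a}, T c b → T b a → T c a := by
    rintro c b a ⟨h1, h2, -⟩ ⟨k1, k2, -⟩
    refine ⟨k1.trans h1, h2.trans k2, ?_⟩
    rintro ⟨rfl, rfl⟩
    exact absurd ((descent_lt_left_iff hα b).1 k2) (not_le.2 h2)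
  have hco : ∀ {c b a}, T c a → a < b → b < c → T c b ∨ T b a := by
    rintro c b a ⟨h1, h2, h3⟩ hab hbc
    rcases lt_or_ge (σ.symm c) (σ.symm b) with q | q
    · by_cases hc : c = α.right ∧ b = α.left
      · right
        refine ⟨hab, ?_, fun k => α.lt.ne' (k.1.symm.trans hc.2)⟩
        rcases hc with ⟨rfl, rfl⟩
        by_contra hcon
        rcases (not_lt.1 hcon).lt_or_eq with k | k
        · exact absurd ((descent_lt_left_iff hα a).1 k) (not_le.2 h2)
        · exact hab.ne (σ.symm.injective k)
      · exact Or.inl ⟨hbc, q, hc⟩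
    · have q' : σ.symm b < σ.symm c := lt_of_le_of_ne q fun e => hbc.ne (σ.symm.injective e)
      by_cases hc : b = α.right ∧ a = α.left
      · rcases hc with ⟨rfl, rfl⟩
        exact absurd ((descent_lt_left_iff hα c).1 h2) (not_le.2 q')
      · exact Or.inr ⟨hab, q'.trans h2, hc⟩
  obtain ⟨ρ, hρ⟩ := exists_perm_of_biclosed T (fun h => h.1) htrans hco
  exact ⟨ρ, fun x y hxy => (hρ x y hxy).trans (and_iff_right hxy)⟩

end Descent

/-- A permutation is the least one inverting its descents among those below it. -/
theorem le_of_descents_inverted {n : ℕ} {ρ σ : Equiv.Perm (Fin n)} (hle : ρ ≤ σ)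
    (h : ∀ α ∈ descentDiagram σ, ρ.symm α.right < ρ.symm α.left) : σ ≤ ρ := by
  have hle' : ∀ a b : Fin n, a < b → σ.symm a < σ.symm b → ρ.symm a < ρ.symm b := by
    intro a b hab k
    by_contra hc
    have := (weakOrder_le_iff _ _).1 hle a b hab
      (lt_of_le_of_ne (not_lt.1 hc) fun e => hab.ne' (ρ.symm.injective e))
    exact absurd this k.asymm
  -- Induction on the distance between positions. The entry `e` right after `y` splits the pair.
  -- Each half is either a noninversion of `σ`, inherited by `ρ ≤ σ`, or an inversion at smaller
  -- distance.
  have key : ∀ (d : ℕ) (x y : Fin n), x < y → (σ.symm x : ℕ) = σ.symm y + d + 1 →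
      ρ.symm y < ρ.symm x := by
    intro d
    induction d using Nat.strong_induction_on with
    | _ d ih =>
      intro x y hxy hd
      rcases Nat.eq_zero_or_pos d with rfl | hpos
      · obtain ⟨α, hα, rfl, rfl⟩ := exists_mem_descentDiagram σ hxy (by omega)
        exact h α hα
      · have hlt : (σ.symm y : ℕ) + 1 < n := by
          have := (σ.symm x).isLt
          omega
        obtain ⟨e, he⟩ : ∃ e, σ.symm e = ⟨σ.symm y + 1, hlt⟩ := ⟨σ ⟨_, hlt⟩, by simp⟩
        have he' : (σ.symm e : ℕ) = σ.symm y + 1 := by rw [he]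
        have hye : σ.symm y < σ.symm e := by rw [Fin.lt_def]; omega
        have hex : σ.symm e < σ.symm x := by rw [Fin.lt_def]; omega
        have h1 : ρ.symm y < ρ.symm e := by
          rcases lt_trichotomy y e with q | q | q
          · exact hle' y e q hye
          · exact absurd hye (by simp [q])
          · exact ih 0 (by omega) e y q (by omega)
        have h2 : ρ.symm e < ρ.symm x := by
          rcases lt_trichotomy e x with q | q | q
          · exact hle' e x q hex
          · exact absurd hex (by simp [q])
          · exact ih (d - 1) (by omega) x e q (by omega)
        exact h1.trans h2
  refine (weakOrder_le_iff _ _).2 fun a b hab k => ?_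
  rw [Fin.lt_def] at k
  exact key (σ.symm a - σ.symm b - 1) a b hab (by omega)

/-- A permutation is the join of the join-irreducible permutations of its descents. -/
theorem le_of_forall_below {n : ℕ} {σ τ : Equiv.Perm (Fin n)}
    (h : ∀ α ∈ descentDiagram σ, α.Below τ) : σ ≤ τ := by
  have : σ ≤ σ ⊓ τ := le_of_descents_inverted inf_le_left fun α hα =>
    ((α.below_inf σ τ).2 ⟨below_of_mem_descentDiagram hα, h α hα⟩) _ _ le_rfl α.lt le_rfl
      α.left_notMem (Or.inr rfl)
  exact this.trans inf_le_right

theorem descentDiagram_injective {n : ℕ} :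
    Function.Injective (descentDiagram : Equiv.Perm (Fin n) → Finset (Arc n)) := by
  intro σ τ h
  refine le_antisymm (le_of_forall_below fun α hα => ?_) (le_of_forall_below fun α hα => ?_)
  · exact below_of_mem_descentDiagram (h ▸ hα)
  · exact below_of_mem_descentDiagram (h ▸ hα)

/-! ### Noncrossing arc diagrams are exactly descent diagrams -/

theorem Arc.Cross.symm {n : ℕ} {α β : Arc n} (h : α.Cross β) : β.Cross α := by
  obtain ⟨r, hr, s, hs, h1, h2⟩ := h
  refine ⟨s, ?_, r, ?_, h2, h1⟩
  · rwa [inter_comm, inter_comm {β.left, β.right}]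
  · rwa [inter_comm, inter_comm {β.left, β.right}]

theorem isNoncrossing_descentDiagram {n : ℕ} (σ : Equiv.Perm (Fin n)) :
    IsNoncrossing (descentDiagram σ) := by
  have hpos : ∀ α ∈ descentDiagram σ, ∀ r, r ∈ α.above ∪ {α.left, α.right} →
      σ.symm r ≤ σ.symm α.left := by
    intro α hα r hr
    simp only [mem_union, mem_insert, mem_singleton] at hr
    rcases hr with hr | rfl | rfl
    · obtain ⟨h1, h2⟩ := Arc.lt_of_mem hr
      exact (((descent_mem_above hα h1 h2).1 hr).trans (descent_lt hα)).le
    · exact le_rfl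
    · exact (descent_lt hα).le
  -- If the descent of `α` comes first, every point of `α` counted in a crossing stands at or before
  -- `β.right`. It is then in `β.above`, unless it is both `α.left` and `β.right`, a common endpoint
  -- that the definition of crossing excludes.
  have hcross : ∀ α ∈ descentDiagram σ, ∀ β ∈ descentDiagram σ,
      σ.symm α.right < σ.symm β.right → ¬ α.Cross β := by
    rintro α hα β hβ hlt ⟨r, hr, -, -, hr', -⟩
    simp only [mem_sdiff, mem_inter, mem_Icc, mem_insert, mem_singleton] at hr
    obtain ⟨⟨-, hr1, hr2⟩, hr3⟩ := hr
    obtain ⟨h1, h2⟩ := mem_sdiff.1 hr'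
    have h3 := hpos α hα r h1
    have hab := ((mem_descentDiagram σ α).1 hα).1
    have hcd := ((mem_descentDiagram σ β).1 hβ).1
    have h4 : σ.symm r ≤ σ.symm β.right := by
      rw [Fin.le_def] at h3 ⊢
      rw [Fin.lt_def] at hlt
      omega
    have hrl : β.left ≠ r := fun e => absurd (descent_lt hβ) (not_lt.2 (e ▸ h4))
    rcases hr2.lt_or_eq with q | q
    · refine h2 ((descent_mem_above hβ (lt_of_le_of_ne hr1 hrl) q).2 ?_)
      exact lt_of_le_of_ne h4 fun e => q.ne (σ.symm.injective e)
    · have : σ.symm r = σ.symm α.left := by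
        rw [q] at h3 ⊢
        refine le_antisymm h3 ?_
        rw [Fin.le_def]
        rw [Fin.lt_def] at hlt
        omega
      exact hr3 ⟨Or.inl (σ.symm.injective this), Or.inr q⟩
  have hext : ∀ α ∈ descentDiagram σ, ∀ β ∈ descentDiagram σ, α.right = β.right → α = β := by
    intro α hα β hβ h
    have hab := ((mem_descentDiagram σ α).1 hα)
    have hcd := ((mem_descentDiagram σ β).1 hβ)
    have hl : α.left = β.left := by
      apply σ.symm.injective
      ext
      rw [hab.1, hcd.1, h]
    exact Arc.ext_fields hl h (by rw [hab.2, hcd.2, hl, h])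
  intro α hα β hβ hne
  have hr : α.right ≠ β.right := fun e => hne (hext α hα β hβ e)
  refine ⟨?_, fun e => ?_, hr⟩
  · rcases lt_trichotomy (σ.symm α.right) (σ.symm β.right) with q | q | q
    · exact hcross α hα β hβ q
    · exact absurd (σ.symm.injective q) hr
    · exact fun h => hcross β hβ α hα q h.symm
  · have hab := ((mem_descentDiagram σ α).1 hα).1
    have hcd := ((mem_descentDiagram σ β).1 hβ).1
    rw [e] at hab
    exact hr (σ.symm.injective (Fin.ext (by omega)))

/-- The inversions of the join-irreducible permutation of an arc `β` are not among the noninversions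
of the meet-irreducible permutation of an arc that is compatible with `β`. -/
theorem Arc.Inv.not_noninversion {n : ℕ} {α β : Arc n} (hc : ¬ α.Cross β)
    (hl : α.left ≠ β.left) (hr : α.right ≠ β.right) {x y : Fin n} (h : β.Inv y x)
    (hax : α.left ≤ x) (hyb : y ≤ α.right) (hx : x ∈ α.above ∨ x = α.left)
    (hy : y ∉ α.above) : False := by
  obtain ⟨h1, h2, h3, h4, h5⟩ := h
  apply hc
  -- The inverted values are the witnesses of a crossing: `x` is above `β` or at an end of `α`, and
  -- `y` plays the opposite role.
  refine ⟨x, ?_, y, ?_, ?_, ?_⟩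
  · simp only [mem_sdiff, mem_inter, mem_Icc, mem_insert, mem_singleton]
    refine ⟨⟨⟨hax, h2.le.trans hyb⟩, h1, h2.le.trans h3⟩, ?_⟩
    rintro ⟨q | q, q' | q'⟩
    · exact hl (q.symm.trans q')
    · exact absurd (q' ▸ h2) (not_lt.2 h3)
    · exact absurd (q ▸ h2) (not_lt.2 hyb)
    · exact absurd (q' ▸ h2) (not_lt.2 h3)
  · simp only [mem_sdiff, mem_inter, mem_Icc, mem_insert, mem_singleton]
    refine ⟨⟨⟨hax.trans h2.le, hyb⟩, h1.trans h2.le, h3⟩, ?_⟩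
    rintro ⟨q | q, q' | q'⟩
    · exact absurd (q ▸ h2) (not_lt.2 hax)
    · exact absurd (q ▸ h2) (not_lt.2 hax)
    · exact absurd (q' ▸ h2) (not_lt.2 h1)
    · exact hr (q.symm.trans q')
  · simp only [mem_sdiff, mem_union, mem_insert, mem_singleton]
    exact ⟨by tauto, h4⟩
  · simp only [mem_sdiff, mem_union, mem_insert, mem_singleton]
    exact ⟨by tauto, hy⟩

/-- Every noncrossing arc diagram is the diagram of a permutation. -/
theorem exists_descentDiagram_eq {n : ℕ} {D : Finset (Arc n)} (hD : IsNoncrossing D) :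
    ∃ σ : Equiv.Perm (Fin n), descentDiagram σ = D := by
  -- The transitive closure of `R` is the inversion set of the join of the join-irreducibles of the
  -- arcs of `D`; this join is the required permutation.
  let R : Fin n → Fin n → Prop := fun y x => ∃ γ ∈ D, γ.Inv y x
  have hgt : ∀ {b a}, Relation.TransGen R b a → a < b := by
    intro b a h
    induction h with
    | single h => obtain ⟨γ, -, h⟩ := h; exact h.2.1
    | tail _ h ih => obtain ⟨γ, -, h⟩ := h; exact h.2.1.trans ih
  have hco : ∀ {c b a}, Relation.TransGen R c a → a < b → b < c →
      Relation.TransGen R c b ∨ Relation.TransGen R b a := by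
    intro c b a h
    induction h with
    | single h =>
      obtain ⟨γ, hγ, h⟩ := h
      intro h1 h2
      exact (h.cotrans h1 h2).imp (fun k => .single ⟨γ, hγ, k⟩) fun k => .single ⟨γ, hγ, k⟩
    | @tail x a hx h ih =>
      intro h1 h2
      rcases lt_trichotomy b x with q | q | q
      · obtain ⟨γ, hγ, h⟩ := h
        rcases h.cotrans h1 q with k | k
        · exact Or.inl (hx.tail ⟨γ, hγ, k⟩)
        · exact Or.inr (.single ⟨γ, hγ, k⟩)
      · subst q; exact Or.inl hx
      · exact (ih q h2).imp id fun k => k.tail h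
  obtain ⟨σ, hσ⟩ := exists_perm_of_biclosed (Relation.TransGen R) hgt
    (fun h k => h.trans k) hco
  have hinv : ∀ γ ∈ D, ∀ y x, γ.Inv y x → σ.symm y < σ.symm x := fun γ hγ y x h =>
    (hσ x y h.2.1).2 (.single ⟨γ, hγ, h⟩)
  -- the noninversions of the meet-irreducible permutation of an arc of the diagram
  have hgen : ∀ α ∈ D, ∀ y x, R y x → α.left ≤ x → y ≤ α.right →
      (x ∈ α.above ∨ x = α.left) → y ∉ α.above → y = α.right ∧ x = α.left := by
    rintro α hα y x ⟨γ, hγ, h⟩ h1 h2 h3 h4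
    by_cases hne : α = γ
    · subst hne
      exact ⟨h.2.2.2.2.resolve_left h4, h3.resolve_left h.2.2.2.1⟩
    · obtain ⟨q1, q2, q3⟩ := hD α hα γ hγ hne
      exact (h.not_noninversion q1 q2 q3 h1 h2 h3 h4).elim
  -- A chain of generators cannot produce a new exception: its last intermediate value `z` is in `S`
  -- or not, and in either case one of the two parts would already have to be the pair of ends of
  -- `α`, which `z` makes impossible.
  have hnon : ∀ α ∈ D, ∀ y x, Relation.TransGen R y x → α.left ≤ x → y ≤ α.right →
      (x ∈ α.above ∨ x = α.left) → y ∉ α.above → y = α.right ∧ x = α.left := by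
    intro α hα y x h
    induction h with
    | single h => exact hgen α hα _ _ h
    | @tail z x hz h ih =>
      intro h1 h2 h3 h4
      have hzx : x < z := hgt (.single h)
      have hyz := hgt hz
      by_cases hza : z ∈ α.above
      · have := ih (h1.trans hzx.le) h2 (Or.inl hza) h4
        exact absurd (this.2 ▸ hzx) (not_lt.2 h1)
      · have := hgen α hα _ _ h h1 (hyz.le.trans h2) h3 hza
        exact absurd (this.1 ▸ hyz) (not_lt.2 h2)
  have hmem : ∀ α ∈ D, ∀ v, α.left < v → v < α.right →
      (v ∈ α.above → σ.symm v < σ.symm α.right) ∧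
      (v ∉ α.above → σ.symm α.left < σ.symm v) := by
    intro α hα v h1 h2
    constructor
    · intro hv
      by_contra hc
      have := (hσ v α.right h2).1
        (lt_of_le_of_ne (not_lt.1 hc) fun e => h2.ne' (σ.symm.injective e))
      have := hnon α hα _ _ this h1.le le_rfl (Or.inl hv) α.right_notMem
      exact h1.ne' this.2
    · intro hv
      by_contra hc
      have := (hσ α.left v h1).1
        (lt_of_le_of_ne (not_lt.1 hc) fun e => h1.ne' (σ.symm.injective e))
      have := hnon α hα _ _ this le_rfl h2.le (Or.inr rfl) hv
      exact h2.ne this.1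
  -- no larger value lies between the two ends of an arc
  have hbig' : ∀ α ∈ D, ∀ c z, R c z → α.right < c →
      σ.symm α.right < σ.symm c → α.left ≤ z → z ≤ α.right → σ.symm z ≤ σ.symm α.left →
      False := by
    intro α hα c z h h1 h2 h3 h4 h5
    have hzr : σ.symm c < σ.symm z := (hσ _ _ (hgt (.single h))).2 (.single h)
    -- By `hmem`, no value strictly between the ends of `α` stands between them in position.
    have hz : z = α.left := by
      by_contra hza
      have h3' := lt_of_le_of_ne h3 (Ne.symm hza)
      rcases h4.lt_or_eq with q | q
      · by_cases hz : z ∈ α.above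
        · exact absurd ((hmem α hα z h3' q).1 hz) (h2.trans hzr).asymm
        · exact absurd ((hmem α hα z h3' q).2 hz) (not_lt.2 h5)
      · exact absurd h2 (q ▸ hzr).asymm
    subst hz
    obtain ⟨γ, hγ, k1, k2, k3, k4, k5⟩ := h
    have hne : α ≠ γ := by
      rintro rfl
      exact absurd k3 (not_le.2 h1)
    obtain ⟨q1, q2, q3⟩ := hD α hα γ hγ hne
    -- Otherwise `γ` would place `c` before `α.right`. Once `α.right` is above `γ`, the arc `γ`
    -- inverts both ends of `α`, which noncrossing forbids.
    have hb : α.right ∈ γ.above := by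
      by_contra hb
      exact absurd h2 (hinv γ hγ _ _ ⟨k1.trans α.lt.le, h1, k3, hb, k5⟩).asymm
    exact Arc.Inv.not_noninversion q1 q2 q3 (y := α.right) (x := α.left)
      ⟨k1, α.lt, h1.le.trans k3, k4, Or.inl hb⟩ le_rfl le_rfl (Or.inr rfl) α.right_notMem
  have hbig : ∀ α ∈ D, ∀ c z, Relation.TransGen R c z → α.right < c →
      σ.symm α.right < σ.symm c → α.left ≤ z → z ≤ α.right → σ.symm z ≤ σ.symm α.left →
      False := by
    intro α hα c z h
    induction h with
    | single h => exact hbig' α hα _ _ h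
    | @tail w z hw h ih =>
      intro h1 h2 h3 h4 h5
      have hwz : z < w := hgt (.single h)
      rcases le_or_gt w α.right with q | q
      · exact ih h1 h2 (h3.trans hwz.le) q (((hσ _ _ hwz).2 (.single h)).le.trans h5)
      · exact hbig' α hα _ _ h q (h2.trans ((hσ _ _ (hgt hw)).2 hw)) h3 h4 h5
  -- no smaller value lies between the two ends of an arc
  have hsmall' : ∀ α ∈ D, ∀ z c, R z c → c < α.left →
      σ.symm c < σ.symm α.left → α.left ≤ z → z ≤ α.right → σ.symm α.right ≤ σ.symm z →
      False := by
    intro α hα z c h h1 h2 h3 h4 h5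
    have hzr : σ.symm z < σ.symm c := (hσ _ _ (hgt (.single h))).2 (.single h)
    have hz : z = α.right := by
      by_contra hza
      have h4' := lt_of_le_of_ne h4 hza
      rcases h3.lt_or_eq with q | q
      · by_cases hz : z ∈ α.above
        · exact absurd ((hmem α hα z q h4').1 hz) (not_lt.2 h5)
        · exact absurd ((hmem α hα z q h4').2 hz) (hzr.trans h2).asymm
      · exact absurd h2 (q ▸ hzr).asymm
    subst hz
    obtain ⟨γ, hγ, k1, k2, k3, k4, k5⟩ := h
    have hne : α ≠ γ := by
      rintro rfl
      exact absurd k1 (not_le.2 h1)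
    obtain ⟨q1, q2, q3⟩ := hD α hα γ hγ hne
    have hb : α.left ∉ γ.above := by
      intro hb
      exact absurd h2 (hinv γ hγ _ _ ⟨k1, h1, α.lt.le.trans k3, k4, Or.inl hb⟩).asymm
    exact Arc.Inv.not_noninversion q1 q2 q3 (y := α.right) (x := α.left)
      ⟨k1.trans h1.le, α.lt, k3, hb, k5⟩ le_rfl le_rfl (Or.inr rfl) α.right_notMem
  have hsmall : ∀ α ∈ D, ∀ z c, Relation.TransGen R z c → c < α.left →
      σ.symm c < σ.symm α.left → α.left ≤ z → z ≤ α.right → σ.symm α.right ≤ σ.symm z →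
      False := by
    intro α hα z c h
    induction h with
    | single h => exact hsmall' α hα _ _ h
    | @tail w c hw h ih =>
      intro h1 h2 h3 h4 h5
      have hwc : σ.symm w < σ.symm c := (hσ _ _ (hgt (.single h))).2 (.single h)
      rcases le_or_gt α.left w with q | q
      · exact hsmall' α hα _ _ h h1 h2 q ((hgt hw).le.trans h4)
          (h5.trans ((hσ _ _ (hgt hw)).2 hw).le)
      · exact ih q (hwc.trans h2) h3 h4 h5
  have hsub : ∀ α ∈ D, α ∈ descentDiagram σ := by
    intro α hα
    have hlt := hinv α hα _ _ α.inv_right_left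
    refine (mem_descentDiagram σ α).2 ⟨?_, ?_⟩
    · by_contra hne
      have hlt' : (σ.symm α.right : ℕ) < σ.symm α.left := hlt
      have hltn : (σ.symm α.right : ℕ) + 1 < n := by
        have := (σ.symm α.left).isLt
        omega
      obtain ⟨c, hc⟩ : ∃ c, σ.symm c = ⟨σ.symm α.right + 1, hltn⟩ := ⟨σ ⟨_, hltn⟩, by simp⟩
      have hc' : (σ.symm c : ℕ) = σ.symm α.right + 1 := by rw [hc]
      have h1 : σ.symm α.right < σ.symm c := by rw [Fin.lt_def]; omega
      have h2 : σ.symm c < σ.symm α.left := by rw [Fin.lt_def]; omega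
      rcases lt_trichotomy c α.left with q | q | q
      · exact hsmall α hα _ _ ((hσ _ _ (q.trans α.lt)).1 h1) q h2 α.lt.le le_rfl le_rfl
      · exact h2.ne (by rw [q])
      rcases lt_trichotomy c α.right with q' | q' | q'
      · by_cases hca : c ∈ α.above
        · exact absurd ((hmem α hα c q q').1 hca) h1.asymm
        · exact absurd ((hmem α hα c q q').2 hca) h2.asymm
      · exact h1.ne (by rw [q'])
      · exact hbig α hα _ _ ((hσ _ _ q).1 h2) q' h1 le_rfl α.lt.le le_rfl
    · ext v
      rw [mem_filter, mem_Ioo]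
      constructor
      · intro hv
        have h := Arc.lt_of_mem hv
        exact ⟨h, (hmem α hα v h.1 h.2).1 hv⟩
      · rintro ⟨h, hv⟩
        by_contra hc
        exact absurd ((hmem α hα v h.1 h.2).2 hc) (hv.trans hlt).asymm
  refine ⟨σ, Finset.Subset.antisymm (fun β hβ => ?_) hsub⟩
  -- An intermediate value of a longer chain would stand between two adjacent entries.
  have hdir : R β.right β.left := by
    have h := (hσ _ _ β.lt).1 (descent_lt hβ)
    cases h with
    | single h => exact h
    | @tail z _ hz h =>
      have h1 := (hσ _ _ (hgt hz)).2 hz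
      have h2 := (hσ _ _ (hgt (.single h))).2 (.single h)
      exact absurd ((descent_lt_left_iff hβ z).1 h2) (not_le.2 h1)
  obtain ⟨α, hα, h⟩ := hdir
  have hα' := hsub α hα
  -- If the right ends differed, `α.right` would stand strictly between `β.right` and `β.left`.
  have key : α.right = β.right := by
    by_contra hne
    have hup : β.right ∈ α.above := h.2.2.2.2.resolve_right (Ne.symm hne)
    have h1 : σ.symm β.right < σ.symm α.right := (hmem α hα _ (Arc.lt_of_mem hup).1
      (Arc.lt_of_mem hup).2).1 hup
    have h2 : σ.symm α.right < σ.symm β.left := hinv α hα _ _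
      ⟨h.1, h.2.1.trans (Arc.lt_of_mem hup).2, le_rfl, h.2.2.2.1, Or.inr rfl⟩
    exact absurd ((descent_lt_left_iff hβ _).1 h2) (not_le.2 h1)
  by_contra hβD
  have hne : α ≠ β := fun e => hβD (e ▸ hα)
  exact (isNoncrossing_descentDiagram σ α hα' β hβ hne).2.2 key

/-! ### The congruence of an arc ideal -/

section ProjDown

variable {n : ℕ} (r : LatticeCon (Equiv.Perm (Fin n))) {σ τ : Equiv.Perm (Fin n)}

theorem projDown_le_of_rel (h : r.r σ τ) : projDown r σ ≤ τ := by
  classical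
  exact inf'_le (s := univ.filter fun τ => r.r σ τ) id (by simpa using h)

theorem rel_projDown (σ : Equiv.Perm (Fin n)) : r.r σ (projDown r σ) := by
  classical
  refine inf'_induction (p := fun x => r.r σ x) _ id (fun x hx y hy => ?_) fun x hx => ?_
  · simpa using r.inf hx hy
  · simpa using hx

theorem projDown_eq_of_rel (h : r.r σ τ) : projDown r σ = projDown r τ :=
  le_antisymm (projDown_le_of_rel r (r.iseqv.trans h (rel_projDown r τ)))
    (projDown_le_of_rel r (r.iseqv.trans (r.iseqv.symm h) (rel_projDown r σ)))

theorem projDown_eq_iff : projDown r σ = projDown r τ ↔ r.r σ τ :=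
  ⟨fun h => r.iseqv.trans (rel_projDown r σ) (h ▸ r.iseqv.symm (rel_projDown r τ)),
    projDown_eq_of_rel r⟩

theorem projDown_projDown (σ : Equiv.Perm (Fin n)) :
    projDown r (projDown r σ) = projDown r σ :=
  (projDown_eq_of_rel r (rel_projDown r σ)).symm

end ProjDown

/-! ### Join-irreducible permutations and lower covers -/

theorem Arc.below_joinIrr {n : ℕ} (α : Arc n) : α.Below α.joinIrr :=
  (α.joinIrr_le_iff _).1 le_rfl

theorem eq_joinIrr_of_descentDiagram_eq {n : ℕ} {σ : Equiv.Perm (Fin n)} {α : Arc n}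
    (h : descentDiagram σ = {α}) : σ = α.joinIrr := by
  refine le_antisymm (le_of_forall_below fun β hβ => ?_) ((α.joinIrr_le_iff σ).2 ?_)
  · rw [h, mem_singleton] at hβ
    exact hβ ▸ α.below_joinIrr
  · exact below_of_mem_descentDiagram (by simp [h])

theorem descentDiagram_joinIrr {n : ℕ} (α : Arc n) : descentDiagram α.joinIrr = {α} := by
  obtain ⟨σ, hσ⟩ := exists_descentDiagram_eq (D := {α}) (by
    intro β hβ γ hγ hne
    rw [mem_singleton] at hβ hγ
    exact absurd (hβ.trans hγ.symm) hne)
  rw [← eq_joinIrr_of_descentDiagram_eq hσ, hσ]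

/-- The element covered by a permutation at one of its descents. -/
theorem exists_lowerCover {n : ℕ} {σ : Equiv.Perm (Fin n)} {α : Arc n}
    (hα : α ∈ descentDiagram σ) : ∃ ρ < σ,
      (∀ τ ≤ σ, ¬ τ.symm α.right < τ.symm α.left → τ ≤ ρ) ∧
      (∀ β : Arc n, β.Below σ → ¬ β.Below ρ → β.Inv α.right α.left) ∧
      ∀ τ, ρ ≤ τ → α.Below τ → σ ≤ τ := by
  obtain ⟨ρ, hρ⟩ := exists_remove_descent hα
  have hle : ρ ≤ σ := (weakOrder_le_iff _ _).2 fun a b hab h => ((hρ a b hab).1 h).1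
  have hnot : ¬ ρ.symm α.right < ρ.symm α.left := fun h => ((hρ _ _ α.lt).1 h).2 ⟨rfl, rfl⟩
  refine ⟨ρ, lt_of_le_of_ne hle fun e => hnot (e ▸ descent_lt hα), ?_, ?_, ?_⟩
  · intro τ hτ h
    refine (weakOrder_le_iff _ _).2 fun a b hab k => (hρ a b hab).2
      ⟨(weakOrder_le_iff _ _).1 hτ a b hab k, ?_⟩
    rintro ⟨rfl, rfl⟩
    exact h k
  · intro β hβ hβ'
    rw [Arc.below_iff] at hβ hβ'
    push Not at hβ'
    obtain ⟨y, x, hi, h⟩ := hβ'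
    by_contra hc
    refine absurd ((hρ x y hi.2.1).2 ⟨hβ y x hi, ?_⟩) (not_lt.2 h)
    rintro ⟨rfl, rfl⟩
    exact hc hi
  · intro τ hτ hα'
    refine (weakOrder_le_iff _ _).2 fun a b hab k => ?_
    by_cases hc : b = α.right ∧ a = α.left
    · rcases hc with ⟨rfl, rfl⟩
      exact hα' _ _ le_rfl α.lt le_rfl α.left_notMem (Or.inr rfl)
    · exact (weakOrder_le_iff _ _).1 hτ a b hab ((hρ a b hab).2 ⟨k, hc⟩)

theorem existsUnique_covBy_of_max {P : Type*} [PartialOrder P] {x y : P} (hxy : x < y)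
    (h : ∀ z < y, z ≤ x) : ∃! z, z ⋖ y := by
  refine ⟨x, ⟨hxy, fun z h1 h2 => (h z h2).not_gt h1⟩, fun z hz => ?_⟩
  exact (h z hz.lt).eq_of_not_lt fun hlt => hz.2 hlt hxy

/-- Anything strictly below fails to invert the only descent, so it lies below the permutation with
that descent removed. -/
theorem existsUnique_covBy_joinIrr {n : ℕ} (α : Arc n) : ∃! τ, τ ⋖ α.joinIrr := by
  have hα : α ∈ descentDiagram α.joinIrr := by simp [descentDiagram_joinIrr]
  obtain ⟨ρ, hlt, h, -⟩ := exists_lowerCover hα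
  refine existsUnique_covBy_of_max hlt fun τ hτ => h τ hτ.le fun hc => hτ.not_ge ?_
  refine le_of_descents_inverted hτ.le fun β hβ => ?_
  rw [descentDiagram_joinIrr, mem_singleton] at hβ
  exact hβ ▸ hc

/-! ### Bottoms of classes, uniqueness of the congruence, and the fibers of `eta` -/

namespace ArcIdeal

variable {n : ℕ} (I : ArcIdeal n) {σ τ : Equiv.Perm (Fin n)}

theorem Le.le_of_subset {I : ArcIdeal n} (h : I.Le σ τ)
    (hσ : (descentDiagram σ : Set (Arc n)) ⊆ I.carrier) : σ ≤ τ :=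
  le_of_forall_below fun α hα => h α (hσ hα) (below_of_mem_descentDiagram hα)

theorem Le.le_of_rev_subset {I : ArcIdeal n} (h : I.Le σ τ)
    (hτ : (descentDiagram (Fin.revPerm.trans τ) : Set (Arc n)) ⊆ I.compl.carrier) : σ ≤ τ :=
  (weakOrder_rev_le_iff _ _).1 (((I.le_rev_iff σ τ).2 h).le_of_subset hτ)

/-- A descent of `σ` inverted by the join-irreducible permutation of an arc below `σ` is a
restriction of this arc. -/
theorem mem_of_inv {α β : Arc n} (hα : α ∈ descentDiagram σ) (hβ : β ∈ I.carrier)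
    (h : β.Inv α.right α.left) (hb : β.Below σ) : α ∈ I.carrier := by
  have : α = β.restrict α.left α.right α.lt := by
    refine Arc.ext_fields rfl rfl ?_
    ext v
    simp only [Arc.restrict, mem_inter, mem_Ioo]
    constructor
    · intro hv
      have hv' := Arc.lt_of_mem hv
      refine ⟨?_, hv'⟩
      by_contra hc
      have := hb v α.right (h.1.trans hv'.1.le) hv'.2 h.2.2.1 hc h.2.2.2.2
      exact this.asymm ((descent_mem_above hα hv'.1 hv'.2).1 hv)
    · rintro ⟨hv, hv'⟩
      have := hb α.left v h.1 hv'.1 (hv'.2.le.trans h.2.2.1) h.2.2.2.1 (Or.inl hv)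
      rw [descent_lt_left_iff hα] at this
      exact (descent_mem_above hα hv'.1 hv'.2).2
        (lt_of_le_of_ne this fun e => hv'.2.ne (σ.symm.injective e))
  rw [this]
  exact I.restrict_mem β hβ _ _ _ h.1 h.2.2.1

/-- If `σ` is a bottom, removing a descent `α` leaves its class, so an arc of `I` detects the
removal. That arc inverts the ends of `α`, and `α` is a restriction of it. Conversely, `σ` is the
join of the join-irreducibles of its descents, so it lies below everything congruent to it. -/
theorem projDown_con_eq_self_iff :
    projDown I.con σ = σ ↔ (descentDiagram σ : Set (Arc n)) ⊆ I.carrier := by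
  constructor
  · intro h α hα
    obtain ⟨ρ, hlt, -, h1, -⟩ := exists_lowerCover hα
    have hnot : ¬ I.con.r σ ρ := fun hr =>
      hlt.not_ge (h ▸ projDown_le_of_rel I.con hr)
    have hnot' : ¬ I.Le σ ρ := fun hr => hnot ⟨hr, I.le_of_le hlt.le⟩
    simp only [ArcIdeal.Le, not_forall] at hnot'
    obtain ⟨β, hβ, hb, hb'⟩ := hnot'
    exact I.mem_of_inv hα hβ (h1 β hb hb') hb
  · intro h
    exact le_antisymm (projDown_le_of_rel _ (I.con.iseqv.refl σ))
      ((rel_projDown I.con σ).1.le_of_subset h)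

theorem uncontractedArcs_con : uncontractedArcs I.con = I.carrier := by
  ext α
  constructor
  · rintro ⟨σ, -, h, hσ⟩
    exact I.projDown_con_eq_self_iff.1 h (by simp [hσ])
  · intro hα
    refine ⟨α.joinIrr, existsUnique_covBy_joinIrr α, ?_, descentDiagram_joinIrr α⟩
    rw [projDown_con_eq_self_iff, descentDiagram_joinIrr]
    simpa using hα

/-- After replacing `σ` by the bottom of its class, it suffices that its descents lie in `I`. A
descent outside `I` would be contracted by `r`, and joining that contraction with the lower cover
would make `σ` congruent to something smaller. -/
theorem projDown_le_of_le {r : LatticeCon (Equiv.Perm (Fin n))}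
    (hr : uncontractedArcs r = I.carrier) (σ τ : Equiv.Perm (Fin n)) (h : I.Le σ τ) :
    projDown r σ ≤ τ := by
  induction σ using WellFoundedLT.induction with
  | ind σ ih =>
    have hle : projDown r σ ≤ σ := projDown_le_of_rel r (r.iseqv.refl σ)
    rcases hle.lt_or_eq with hlt | heq
    · rw [← projDown_projDown]
      exact ih _ hlt ((I.le_of_le hle).trans h)
    rw [heq]
    refine le_of_forall_below fun α hα => ?_
    by_contra hb
    obtain ⟨ρ, hlt, h1, -, h2⟩ := exists_lowerCover hα
    have hαI : α ∉ I.carrier := fun hαI => hb (h α hαI (below_of_mem_descentDiagram hα))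
    have hjle : α.joinIrr ≤ σ := (α.joinIrr_le_iff σ).2 (below_of_mem_descentDiagram hα)
    have hj : α.joinIrr < σ := by
      refine lt_of_le_of_ne hjle fun e => hαI (hr ▸ ?_)
      exact ⟨σ, e ▸ existsUnique_covBy_joinIrr α, heq, e ▸ descentDiagram_joinIrr α⟩
    have hjne : projDown r α.joinIrr ≠ α.joinIrr := by
      intro e
      refine hαI (hr ▸ ?_)
      exact ⟨_, existsUnique_covBy_joinIrr α, e, descentDiagram_joinIrr α⟩
    have hplt : projDown r α.joinIrr < α.joinIrr :=
      lt_of_le_of_ne (projDown_le_of_rel r (r.iseqv.refl _)) hjne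
    have hpρ : projDown r α.joinIrr ≤ ρ := by
      refine h1 _ (hplt.le.trans hjle) fun hc => hplt.not_ge ?_
      refine le_of_descents_inverted hplt.le fun β hβ => ?_
      rw [descentDiagram_joinIrr, mem_singleton] at hβ
      exact hβ ▸ hc
    -- The bottom of the class of `α.joinIrr` is below `ρ`, so replacing the joinand by it turns `σ`
    -- into `ρ`.
    have hsup : ρ ⊔ α.joinIrr = σ := le_antisymm (sup_le hlt.le hjle)
      (h2 _ le_sup_left ((α.joinIrr_le_iff _).1 le_sup_right))
    have hrel := r.sup (r.iseqv.refl ρ) (rel_projDown r α.joinIrr)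
    rw [hsup, sup_eq_left.2 hpρ] at hrel
    exact hlt.not_ge (heq ▸ projDown_le_of_rel r hrel)

/-- Meeting both related elements with an uncontracted `j` below `σ` relates `j` to `j ⊓ τ`. As `j`
is a bottom, `j ≤ τ`. -/
theorem le_of_rel {r : LatticeCon (Equiv.Perm (Fin n))}
    (hr : uncontractedArcs r = I.carrier) (h : r.r σ τ) : I.Le σ τ := by
  intro α hα hb
  rw [← hr] at hα
  obtain ⟨ρ, -, hρ, hα⟩ := hα
  obtain rfl := eq_joinIrr_of_descentDiagram_eq hα
  rw [← Arc.joinIrr_le_iff] at hb ⊢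
  have hrel := r.inf (r.iseqv.refl α.joinIrr) h
  rw [inf_eq_left.2 hb] at hrel
  exact (hρ ▸ projDown_le_of_rel r hrel).trans inf_le_right

/-- The family being intersected contains `I.con`, and each of its members relates any two elements
equivalent for `I.Le`, since their bottoms coincide. This is the uniqueness of the congruence. -/
theorem arcCongruence_rel_iff :
    (arcCongruence I).r σ τ ↔ I.Le σ τ ∧ I.Le τ σ := by
  constructor
  · exact fun h => h I.con I.uncontractedArcs_con
  · intro h r hr
    have key : ∀ σ τ, I.Le σ τ → projDown r σ ≤ projDown r τ := fun σ τ h =>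
      I.projDown_le_of_le hr σ _ (h.trans (I.le_of_rel hr (rel_projDown r τ)))
    exact (projDown_eq_iff r).1 (le_antisymm (key _ _ h.1) (key _ _ h.2))

theorem arcCongruence_eq : arcCongruence I = I.con := by
  have : (arcCongruence I).toSetoid = I.con.toSetoid :=
    Setoid.ext fun σ τ => I.arcCongruence_rel_iff
  cases h : arcCongruence I
  cases h' : I.con
  simp_all

theorem eta_def (σ : Equiv.Perm (Fin n)) : eta I σ = descentDiagram (projDown I.con σ) := by
  rw [eta, arcCongruence_eq]

theorem eta_eq_iff : eta I σ = eta I τ ↔ I.Le σ τ ∧ I.Le τ σ := by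
  rw [eta_def, eta_def, descentDiagram_injective.eq_iff, projDown_eq_iff]
  exact Iff.rfl

theorem isNoncrossing_eta (σ : Equiv.Perm (Fin n)) : IsNoncrossing (eta I σ) :=
  isNoncrossing_descentDiagram _

theorem eta_subset (σ : Equiv.Perm (Fin n)) : (eta I σ : Set (Arc n)) ⊆ I.carrier := by
  rw [eta_def, ← projDown_con_eq_self_iff, projDown_projDown]

theorem exists_eta_eq {D : Finset (Arc n)} (hD : IsNoncrossing D)
    (hDI : (D : Set (Arc n)) ⊆ I.carrier) : ∃ σ, eta I σ = D := by
  obtain ⟨σ, rfl⟩ := exists_descentDiagram_eq hD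
  exact ⟨σ, by rw [eta_def, I.projDown_con_eq_self_iff.2 hDI]⟩

/-- The bottoms of two comparable classes are themselves comparable, so they serve as
representatives. -/
theorem diagramLE_eta_iff : DiagramLE I (eta I σ) (eta I τ) ↔ I.Le σ τ := by
  constructor
  · rintro ⟨σ', τ', h1, h2, h⟩
    exact ((I.eta_eq_iff.1 h1).2.trans (I.le_of_le h)).trans (I.eta_eq_iff.1 h2).1
  · intro h
    have hσ := rel_projDown I.con σ
    have hτ := rel_projDown I.con τ
    refine ⟨projDown I.con σ, projDown I.con τ, I.eta_eq_iff.2 hσ.symm, I.eta_eq_iff.2 hτ.symm,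
      Le.le_of_subset ((hσ.2.trans h).trans hτ.1) ?_⟩
    rw [← projDown_con_eq_self_iff, projDown_projDown]

/-- The fibers of `eta` are intervals, whose ends are described by their descents and ascents. -/
theorem exists_fiber_eq_Icc {D : Finset (Arc n)} (hD : IsNoncrossing D)
    (hDI : (D : Set (Arc n)) ⊆ I.carrier) :
    ∃ μ ν : Equiv.Perm (Fin n), μ ≤ ν ∧ {σ | eta I σ = D} = Set.Icc μ ν ∧
      (descentDiagram μ : Set (Arc n)) ⊆ I.carrier ∧
      (descentDiagram (Fin.revPerm.trans ν) : Set (Arc n)) ⊆ I.compl.carrier := by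
  obtain ⟨σ, rfl⟩ := I.exists_eta_eq hD hDI
  have h1 : (descentDiagram (projDown I.con σ) : Set (Arc n)) ⊆ I.carrier := by
    rw [← projDown_con_eq_self_iff, projDown_projDown]
  have h2 := rel_projDown I.con σ
  -- The top of the class is obtained by reversing the bottom of the reversed class, for the
  -- complementary ideal.
  let ν := Fin.revPerm.trans (projDown I.compl.con (Fin.revPerm.trans σ))
  have h3 : (descentDiagram (Fin.revPerm.trans ν) : Set (Arc n)) ⊆ I.compl.carrier := by
    rw [revPerm_trans_trans, ← projDown_con_eq_self_iff, projDown_projDown]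
  have h4 : I.Le σ ν ∧ I.Le ν σ := by
    rw [← I.le_rev_iff σ ν, ← I.le_rev_iff ν σ, revPerm_trans_trans]
    exact (rel_projDown I.compl.con (Fin.revPerm.trans σ)).symm
  refine ⟨projDown I.con σ, ν, (h2.2.trans h4.1).le_of_subset h1, ?_, h1, h3⟩
  ext τ
  rw [Set.mem_ofPred_eq, eta_eq_iff, Set.mem_Icc]
  constructor
  · rintro ⟨k1, k2⟩
    exact ⟨(h2.2.trans k2).le_of_subset h1, (k1.trans h4.1).le_of_rev_subset h3⟩
  · rintro ⟨k1, k2⟩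
    exact ⟨(I.le_of_le k2).trans h4.2, h2.1.trans (I.le_of_le k1)⟩

/-- The interval of diagrams between the classes of a bottom and of a top element. -/
theorem eta_mem_diagramInterval_iff {μ ν : Equiv.Perm (Fin n)}
    (hμ : (descentDiagram μ : Set (Arc n)) ⊆ I.carrier)
    (hν : (descentDiagram (Fin.revPerm.trans ν) : Set (Arc n)) ⊆ I.compl.carrier) :
    eta I σ ∈ diagramInterval I (eta I μ) (eta I ν) ↔ μ ≤ σ ∧ σ ≤ ν := by
  simp only [diagramInterval, mem_filter, mem_univ, true_and, diagramLE_eta_iff]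
  constructor
  · rintro ⟨-, -, h1, h2⟩
    exact ⟨h1.le_of_subset hμ, h2.le_of_rev_subset hν⟩
  · rintro ⟨h1, h2⟩
    exact ⟨I.isNoncrossing_eta σ, I.eta_subset σ, I.le_of_le h1, I.le_of_le h2⟩

end ArcIdeal

/-! ### Concatenations and the shifted shuffle -/

section Concat

variable {m n : ℕ}

theorem backslash_symm_castAdd (σ : Equiv.Perm (Fin m)) (τ : Equiv.Perm (Fin n)) (v : Fin m) :
    (backslash σ τ).symm (Fin.castAdd n v) = Fin.castAdd n (σ.symm v) := by
  simp [backslash]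

theorem backslash_symm_natAdd (σ : Equiv.Perm (Fin m)) (τ : Equiv.Perm (Fin n)) (v : Fin n) :
    (backslash σ τ).symm (Fin.natAdd m v) = Fin.natAdd m (τ.symm v) := by
  simp [backslash]

theorem slash_symm_castAdd (τ : Equiv.Perm (Fin n)) (σ : Equiv.Perm (Fin m)) (v : Fin m) :
    ((slash τ σ).symm (Fin.castAdd n v) : ℕ) = n + σ.symm v := by
  simp [slash, add_comm]

theorem slash_symm_natAdd (τ : Equiv.Perm (Fin n)) (σ : Equiv.Perm (Fin m)) (v : Fin n) :
    ((slash τ σ).symm (Fin.natAdd m v) : ℕ) = τ.symm v := by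
  simp [slash]

theorem castAdd_lt_castAdd {a b : Fin m} : Fin.castAdd n a < Fin.castAdd n b ↔ a < b := Iff.rfl

theorem natAdd_lt_natAdd {a b : Fin n} : Fin.natAdd m a < Fin.natAdd m b ↔ a < b := by
  rw [Fin.lt_def, Fin.lt_def, Fin.val_natAdd, Fin.val_natAdd, Nat.add_lt_add_iff_left]

theorem castAdd_lt_natAdd (a : Fin m) (b : Fin n) : Fin.castAdd n a < Fin.natAdd m b := by
  rw [Fin.lt_def, Fin.val_castAdd, Fin.val_natAdd]
  have := a.isLt
  omega

theorem castAdd_ne_natAdd (a : Fin m) (b : Fin n) : Fin.castAdd n a ≠ Fin.natAdd m b :=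
  (castAdd_lt_natAdd a b).ne

theorem slash_symm_castAdd_lt (τ : Equiv.Perm (Fin n)) (σ : Equiv.Perm (Fin m)) {a b : Fin m} :
    (slash τ σ).symm (Fin.castAdd n a) < (slash τ σ).symm (Fin.castAdd n b) ↔
      σ.symm a < σ.symm b := by
  rw [Fin.lt_def, Fin.lt_def, slash_symm_castAdd, slash_symm_castAdd, Nat.add_lt_add_iff_left]

theorem slash_symm_natAdd_lt (τ : Equiv.Perm (Fin n)) (σ : Equiv.Perm (Fin m)) {a b : Fin n} :
    (slash τ σ).symm (Fin.natAdd m a) < (slash τ σ).symm (Fin.natAdd m b) ↔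
      τ.symm a < τ.symm b := by
  rw [Fin.lt_def, Fin.lt_def, slash_symm_natAdd, slash_symm_natAdd]

theorem revPerm_trans_slash (τ : Equiv.Perm (Fin n)) (σ : Equiv.Perm (Fin m)) :
    Fin.revPerm.trans (slash τ σ) =
      backslash (Fin.revPerm.trans σ) (Fin.revPerm.trans τ) := by
  apply Equiv.symm_bijective.injective
  ext v
  rw [symm_revPerm_trans]
  induction v using Fin.addCases with
  | left v =>
    rw [backslash_symm_castAdd, symm_revPerm_trans, Fin.val_rev, slash_symm_castAdd,
      Fin.val_castAdd, Fin.val_rev]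
    omega
  | right v =>
    rw [backslash_symm_natAdd, symm_revPerm_trans, Fin.val_rev, slash_symm_natAdd,
      Fin.val_natAdd, Fin.val_rev]
    have := (τ.symm v).isLt
    omega

theorem castAdd_mem_map_castAdd {S : Finset (Fin m)} {v : Fin m} :
    Fin.castAdd n v ∈ S.map (Fin.castAddEmb n) ↔ v ∈ S :=
  mem_map' _

theorem natAdd_mem_map_natAdd {S : Finset (Fin n)} {v : Fin n} :
    Fin.natAdd m v ∈ S.map (Fin.natAddEmb m) ↔ v ∈ S :=
  mem_map' _

theorem natAdd_notMem_map_castAdd (S : Finset (Fin m)) (v : Fin n) :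
    Fin.natAdd m v ∉ S.map (Fin.castAddEmb n) := by
  intro h
  obtain ⟨a, -, h⟩ := mem_map.1 h
  exact castAdd_ne_natAdd a v h

theorem castAdd_notMem_map_natAdd (S : Finset (Fin n)) (v : Fin m) :
    Fin.castAdd n v ∉ S.map (Fin.natAddEmb m) := by
  intro h
  obtain ⟨a, -, h⟩ := mem_map.1 h
  exact castAdd_ne_natAdd v a h.symm

theorem Arc.augment_compl (α : Arc m) : (α.augment n).compl = α.compl.augment n := by
  refine Arc.ext_fields rfl rfl ?_
  ext v
  simp only [Arc.compl, Arc.augment, mem_sdiff, mem_Ioo]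
  induction v using Fin.addCases with
  | left v => simp only [castAdd_lt_castAdd, castAdd_mem_map_castAdd, mem_sdiff, mem_Ioo]
  | right v =>
    simp only [(castAdd_lt_natAdd _ v).not_gt, natAdd_notMem_map_castAdd, and_false, false_and]

theorem Arc.shift_compl (α : Arc n) : (α.shift m).compl = α.compl.shift m := by
  refine Arc.ext_fields rfl rfl ?_
  ext v
  simp only [Arc.compl, Arc.shift, mem_sdiff, mem_Ioo]
  induction v using Fin.addCases with
  | left v =>
    simp only [(castAdd_lt_natAdd v _).not_gt, castAdd_notMem_map_natAdd, false_and]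
  | right v => simp only [natAdd_lt_natAdd, natAdd_mem_map_natAdd, mem_sdiff, mem_Ioo]

/-- There is no descent at the junction, and no value of the other block lies between the ends of an
arc, so the sets of values above carry over. -/
theorem mem_descentDiagram_backslash {σ : Equiv.Perm (Fin m)} {τ : Equiv.Perm (Fin n)}
    {α : Arc (m + n)} (hα : α ∈ descentDiagram (backslash σ τ)) :
    (∃ β ∈ descentDiagram σ, α = β.augment n) ∨ ∃ β ∈ descentDiagram τ, α = β.shift m := by
  obtain ⟨h1, h2⟩ := (mem_descentDiagram _ _).1 hα
  obtain ⟨a, b, S, hab, hS⟩ := α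
  simp only at h1 h2
  subst h2
  induction a using Fin.addCases with
  | left a =>
    induction b using Fin.addCases with
    | left b =>
      left
      simp only [backslash_symm_castAdd, Fin.val_castAdd] at h1
      obtain ⟨β, hβ, rfl, rfl⟩ := exists_mem_descentDiagram σ (x := a) (y := b) hab h1
      refine ⟨β, hβ, Arc.ext_fields rfl rfl ?_⟩
      ext v
      simp only [Arc.augment, ((mem_descentDiagram _ _).1 hβ).2, mem_filter, mem_Ioo]
      induction v using Fin.addCases with
      | left v =>
        simp only [backslash_symm_castAdd, castAdd_lt_castAdd, castAdd_mem_map_castAdd,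
          mem_filter, mem_Ioo]
      | right v =>
        simp only [(castAdd_lt_natAdd _ v).not_gt, natAdd_notMem_map_castAdd, and_false,
          false_and]
    | right b =>
      simp only [backslash_symm_castAdd, backslash_symm_natAdd, Fin.val_castAdd,
        Fin.val_natAdd] at h1
      have := (σ.symm a).isLt
      omega
  | right a =>
    induction b using Fin.addCases with
    | left b =>
      have := b.isLt
      rw [Fin.lt_def, Fin.val_castAdd, Fin.val_natAdd] at hab
      omega
    | right b =>
      right
      simp only [backslash_symm_natAdd, Fin.val_natAdd] at h1
      obtain ⟨β, hβ, rfl, rfl⟩ := exists_mem_descentDiagram τ (x := a) (y := b)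
        (natAdd_lt_natAdd.1 hab) (by omega)
      refine ⟨β, hβ, Arc.ext_fields rfl rfl ?_⟩
      ext v
      simp only [Arc.shift, ((mem_descentDiagram _ _).1 hβ).2, mem_filter, mem_Ioo]
      induction v using Fin.addCases with
      | left v =>
        simp only [(castAdd_lt_natAdd v _).not_gt, castAdd_notMem_map_natAdd, false_and]
      | right v =>
        simp only [backslash_symm_natAdd, natAdd_lt_natAdd, natAdd_mem_map_natAdd,
          mem_filter, mem_Ioo]

theorem descentDiagram_backslash_subset {I : ArcIdeal m} {J : ArcIdeal n} {K : ArcIdeal (m + n)}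
    (hI : ∀ α ∈ I.carrier, α.augment n ∈ K.carrier) (hJ : ∀ α ∈ J.carrier, α.shift m ∈ K.carrier)
    {σ : Equiv.Perm (Fin m)} {τ : Equiv.Perm (Fin n)}
    (hσ : (descentDiagram σ : Set (Arc m)) ⊆ I.carrier)
    (hτ : (descentDiagram τ : Set (Arc n)) ⊆ J.carrier) :
    (descentDiagram (backslash σ τ) : Set (Arc (m + n))) ⊆ K.carrier := by
  intro α hα
  rcases mem_descentDiagram_backslash hα with ⟨β, hβ, rfl⟩ | ⟨β, hβ, rfl⟩
  · exact hI β (hσ hβ)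
  · exact hJ β (hτ hβ)

theorem descentDiagram_rev_slash_subset {I : ArcIdeal m} {J : ArcIdeal n} {K : ArcIdeal (m + n)}
    (hI : ∀ α ∈ I.carrier, α.augment n ∈ K.carrier) (hJ : ∀ α ∈ J.carrier, α.shift m ∈ K.carrier)
    {σ : Equiv.Perm (Fin m)} {τ : Equiv.Perm (Fin n)}
    (hσ : (descentDiagram (Fin.revPerm.trans σ) : Set (Arc m)) ⊆ I.compl.carrier)
    (hτ : (descentDiagram (Fin.revPerm.trans τ) : Set (Arc n)) ⊆ J.compl.carrier) :
    (descentDiagram (Fin.revPerm.trans (slash τ σ)) : Set (Arc (m + n))) ⊆ K.compl.carrier := by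
  rw [revPerm_trans_slash]
  refine descentDiagram_backslash_subset (fun α hα => ?_) (fun α hα => ?_) hσ hτ
  · exact (congrArg (· ∈ K.carrier) α.augment_compl).mpr (hI _ hα)
  · exact (congrArg (· ∈ K.carrier) α.shift_compl).mpr (hJ _ hα)

/-! ### Shifted shuffles and weak order intervals -/

theorem stdVal_symm_lt_iff {p q : ℕ} (ρ : Equiv.Perm (Fin p)) (R : Finset (Fin p))
    (hR : R.card = q) (a b : Fin q) :
    (stdVal ρ R hR).symm a < (stdVal ρ R hR).symm b ↔
      ρ.symm (R.orderEmbOfFin hR a) < ρ.symm (R.orderEmbOfFin hR b) := by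
  have h : ∀ c : Fin q, (stdVal ρ R hR).symm c =
      ((R.map ρ.symm.toEmbedding).orderIsoOfFin ((card_map _).trans hR)).symm
        ⟨ρ.symm (R.orderEmbOfFin hR c), by simp⟩ := by
    intro c
    rfl
  rw [h, h, OrderIso.lt_iff_lt]
  exact Iff.rfl

theorem orderEmbOfFin_castAdd (h : (univ.map (Fin.castAddEmb n : Fin m ↪ _)).card = m)
    (a : Fin m) : (univ.map (Fin.castAddEmb n)).orderEmbOfFin h a = Fin.castAdd n a := by
  have := orderEmbOfFin_unique h (f := Fin.castAdd n) (by simp) (Fin.strictMono_castAdd n)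
  exact (congrFun this a).symm

theorem orderEmbOfFin_natAdd (h : (univ.map (Fin.natAddEmb m : Fin n ↪ _)).card = n)
    (a : Fin n) : (univ.map (Fin.natAddEmb m)).orderEmbOfFin h a = Fin.natAdd m a := by
  have := orderEmbOfFin_unique h (f := Fin.natAdd m) (by simp) (Fin.strictMono_natAdd m)
  exact (congrFun this a).symm

/-- A mixed pair is never inverted in `σ\τ`, so it imposes no condition on `ρ`. The other pairs are
read off the two standardizations. -/
theorem backslash_le_iff (σ : Equiv.Perm (Fin m)) (τ : Equiv.Perm (Fin n))
    (ρ : Equiv.Perm (Fin (m + n))) :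
    backslash σ τ ≤ ρ ↔ σ ≤ stdVal ρ (univ.map (Fin.castAddEmb n)) (by simp) ∧
      τ ≤ stdVal ρ (univ.map (Fin.natAddEmb m)) (by simp) := by
  simp only [weakOrder_le_iff, stdVal_symm_lt_iff, orderEmbOfFin_castAdd, orderEmbOfFin_natAdd]
  constructor
  · intro h
    refine ⟨fun a b hab k => h _ _ hab ?_, fun a b hab k => h _ _ (natAdd_lt_natAdd.2 hab) ?_⟩
    · rwa [backslash_symm_castAdd, backslash_symm_castAdd, castAdd_lt_castAdd]
    · rwa [backslash_symm_natAdd, backslash_symm_natAdd, natAdd_lt_natAdd]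
  · rintro ⟨h1, h2⟩ a b hab k
    induction a using Fin.addCases with
    | left a =>
      induction b using Fin.addCases with
      | left b =>
        rw [backslash_symm_castAdd, backslash_symm_castAdd, castAdd_lt_castAdd] at k
        exact h1 a b hab k
      | right b =>
        rw [backslash_symm_castAdd, backslash_symm_natAdd] at k
        exact absurd k (castAdd_lt_natAdd _ _).asymm
    | right a =>
      induction b using Fin.addCases with
      | left b => exact absurd hab (castAdd_lt_natAdd _ _).asymm
      | right b =>
        rw [backslash_symm_natAdd, backslash_symm_natAdd, natAdd_lt_natAdd] at k
        exact h2 a b (natAdd_lt_natAdd.1 hab) k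

/-- Here every mixed pair is inverted, so again only pairs within one block matter. -/
theorem le_slash_iff (σ : Equiv.Perm (Fin m)) (τ : Equiv.Perm (Fin n))
    (ρ : Equiv.Perm (Fin (m + n))) :
    ρ ≤ slash τ σ ↔ stdVal ρ (univ.map (Fin.castAddEmb n)) (by simp) ≤ σ ∧
      stdVal ρ (univ.map (Fin.natAddEmb m)) (by simp) ≤ τ := by
  simp only [weakOrder_le_iff, stdVal_symm_lt_iff, orderEmbOfFin_castAdd, orderEmbOfFin_natAdd]
  constructor
  · intro h
    exact ⟨fun a b hab k => (slash_symm_castAdd_lt τ σ).1 (h _ _ hab k),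
      fun a b hab k => (slash_symm_natAdd_lt τ σ).1 (h _ _ (natAdd_lt_natAdd.2 hab) k)⟩
  · rintro ⟨h1, h2⟩ a b hab k
    induction a using Fin.addCases with
    | left a =>
      induction b using Fin.addCases with
      | left b => exact (slash_symm_castAdd_lt τ σ).2 (h1 a b hab k)
      | right b =>
        rw [Fin.lt_def, slash_symm_castAdd, slash_symm_natAdd]
        have := (τ.symm b).isLt
        omega
    | right a =>
      induction b using Fin.addCases with
      | left b => exact absurd hab (castAdd_lt_natAdd _ _).asymm
      | right b => exact (slash_symm_natAdd_lt τ σ).2 (h2 a b (natAdd_lt_natAdd.1 hab) k)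

end Concat

/-! ### Expanding the product over shifted shuffles -/

theorem product_basisF {k : Type v} [Field k] {𝔛 : DecorationSet.{u}} {m n : ℕ}
    (σ : Equiv.Perm (Fin m)) (τ : Equiv.Perm (Fin n)) (X : 𝔛.carrier m) (Y : 𝔛.carrier n) :
    product k 𝔛 (basisF k 𝔛 σ X) (basisF k 𝔛 τ Y) =
      ∑ ρ ∈ shiftedShuffle σ τ, basisF k 𝔛 ρ (𝔛.concat X Y) := by
  simp [product, basisF]

/-- The fibers of `(g, h)` partition `R`. With `g` and `h` the two standardizations, the fibers are
the shifted shuffles. -/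
theorem sum_filter_sum_filter_fiber {R P Q M : Type*} [Fintype R] [Fintype P] [Fintype Q]
    [DecidableEq P] [DecidableEq Q] [AddCommMonoid M] (f : R → M) (g : R → P) (h : R → Q)
    (p : P → Prop) (q : Q → Prop) [DecidablePred p] [DecidablePred q] :
    ∑ y ∈ univ.filter q, ∑ x ∈ univ.filter p, ∑ ρ ∈ univ.filter (fun ρ => g ρ = x ∧ h ρ = y), f ρ =
      ∑ ρ, if p (g ρ) ∧ q (h ρ) then f ρ else 0 := by
  have : ∀ y x, ∑ ρ ∈ univ.filter (fun ρ => g ρ = x ∧ h ρ = y), f ρ =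
      ∑ ρ, if g ρ = x then if h ρ = y then f ρ else 0 else 0 := by
    intro y x
    simp only [sum_filter, ite_and]
  simp only [this]
  rw [sum_congr rfl fun y _ => sum_comm, sum_comm]
  refine sum_congr rfl fun ρ _ => ?_
  by_cases hp : p (g ρ) <;> by_cases hq : q (h ρ) <;> simp [hp, hq]

end ArcHopf

theorem mainTheorem4 {k : Type v} [Field k] (𝔛 : ArcHopf.DecorationSet.{u})
    (A : ArcHopf.ConservativeFunction 𝔛) {m n : ℕ}
    (X : 𝔛.carrier m) (Y : 𝔛.carrier n)
    (D : Finset (ArcHopf.Arc m)) (E : Finset (ArcHopf.Arc n))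
    (hD : ArcHopf.IsNoncrossing D) (hDX : (D : Set (ArcHopf.Arc m)) ⊆ (A.arcs X).carrier)
    (hE : ArcHopf.IsNoncrossing E) (hEY : (E : Set (ArcHopf.Arc n)) ⊆ (A.arcs Y).carrier) :
    ∃ (μ ν : Equiv.Perm (Fin m)) (lam ω : Equiv.Perm (Fin n)),
      μ ≤ ν ∧ {σ | ArcHopf.eta (A.arcs X) σ = D} = Set.Icc μ ν ∧
      lam ≤ ω ∧ {τ | ArcHopf.eta (A.arcs Y) τ = E} = Set.Icc lam ω ∧
      ArcHopf.product k 𝔛 (ArcHopf.basisP k A D X) (ArcHopf.basisP k A E Y) =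
        ∑ F ∈ ArcHopf.diagramInterval (A.arcs (𝔛.concat X Y))
            (ArcHopf.eta (A.arcs (𝔛.concat X Y)) (ArcHopf.backslash μ lam))
            (ArcHopf.eta (A.arcs (𝔛.concat X Y)) (ArcHopf.slash ω ν)),
          ArcHopf.basisP k A F (𝔛.concat X Y) := by
  classical
  obtain ⟨μ, ν, hμν, hfX, hμ, hν⟩ := (A.arcs X).exists_fiber_eq_Icc hD hDX
  obtain ⟨lam, ω, hlo, hfY, hlam, hω⟩ := (A.arcs Y).exists_fiber_eq_Icc hE hEY
  refine ⟨μ, ν, lam, ω, hμν, hfX, hlo, hfY, ?_⟩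
  have hL := ArcHopf.descentDiagram_backslash_subset (A.augment_mem X Y) (A.shift_mem X Y) hμ hlam
  have hU := ArcHopf.descentDiagram_rev_slash_subset (A.augment_mem X Y) (A.shift_mem X Y) hν hω
  simp only [Set.ext_iff, Set.mem_ofPred_eq, Set.mem_Icc] at hfX hfY
  -- Both conditions say that `ρ` lies between `μ\λ` and `ω/ν` in the weak order.
  have hmem : ∀ ρ : Equiv.Perm (Fin (m + n)),
      ArcHopf.eta (A.arcs (𝔛.concat X Y)) ρ ∈ ArcHopf.diagramInterval (A.arcs (𝔛.concat X Y))
          (ArcHopf.eta (A.arcs (𝔛.concat X Y)) (ArcHopf.backslash μ lam))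
          (ArcHopf.eta (A.arcs (𝔛.concat X Y)) (ArcHopf.slash ω ν)) ↔
        ArcHopf.eta (A.arcs X)
          (ArcHopf.stdVal ρ (Finset.univ.map (Fin.castAddEmb n)) (by simp)) = D ∧
        ArcHopf.eta (A.arcs Y)
          (ArcHopf.stdVal ρ (Finset.univ.map (Fin.natAddEmb m)) (by simp)) = E := by
    intro ρ
    rw [ArcHopf.ArcIdeal.eta_mem_diagramInterval_iff _ hL hU, ArcHopf.backslash_le_iff,
      ArcHopf.le_slash_iff, hfX, hfY]
    exact and_and_and_comm
  simp only [ArcHopf.basisP, map_sum, LinearMap.sum_apply, ArcHopf.product_basisF]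
  -- Both sides become one sum over all `ρ`: on the left by grouping shifted shuffles, on the right
  -- because each `ρ` contributes to the single diagram `eta ρ`.
  trans ∑ ρ : Equiv.Perm (Fin (m + n)),
    if ArcHopf.eta (A.arcs (𝔛.concat X Y)) ρ ∈ ArcHopf.diagramInterval (A.arcs (𝔛.concat X Y))
      (ArcHopf.eta (A.arcs (𝔛.concat X Y)) (ArcHopf.backslash μ lam))
      (ArcHopf.eta (A.arcs (𝔛.concat X Y)) (ArcHopf.slash ω ν))
    then ArcHopf.basisF k 𝔛 ρ (𝔛.concat X Y) else 0
  · simp only [hmem]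
    exact ArcHopf.sum_filter_sum_filter_fiber _ _ _ _ _
  · simp only [Finset.sum_filter]
    rw [Finset.sum_comm]
    refine Finset.sum_congr rfl fun ρ _ => ?_
    rw [Finset.sum_ite_eq]
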